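/- Work on the interval $[0,1]$; for a non-negative weight $w$, $L^2([0,1],w)$ is the real Hilbert space with inner product $\langle f,g\rangle_w=\int_0^1 fg\,w\,dx$. Let $\rho$ be a probability density on $[0,1]$, continuous on $(0,1)$, with first moment $c_1=\int_0^1 t\rho(t)\,dt$, and write $S_w(z)=\int_0^1\frac{w(t)\,dt}{z-t}$ for $z\in\mathbb C\setminus[0,1]$. Suppose $\rho$ has a secondary measure with a density $\mu$, that is, $\mu\ge 0$ is integrable on $[0,1]$ and $S_\mu(z)=z-c_1-\frac1{S_\rho(z)}$ for all $z\in\mathbb C\setminus[0,1]$. Let $T_\rho:L^2([0,1],\rho)\to L^2([0,1],\mu)$ be the continuous linear extension of the operator $p\mapsto\big(x\mapsto\int_0^1\frac{p(t)-p(x)}{t-x}\rho(t)\,dt\big)$ on polynomials, let $H_\rho=\{f\in L^2([0,1],\rho):\langle f,1\rangle_\rho=0\}$, and let $$\varphi(x)=\lim_{\varepsilon\to0^+}2\int_0^1\frac{(x-t)\rho(t)\,dt}{(x-t)^2+\varepsilon^2}$$ be the reducer of $\rho$. Suppose that $\rho$ is reducible: this limit exists for almost every $x\in[0,1]$, it also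 holds in the norm of $L^2([0,1],\rho)$, and $\rho/\mu$ belongs to the image of $T_\rho$. Then the extension $T_\rho$ does exist, and there is a linear isometry $U_\rho$ from $L^2([0,1],\rho^2/\mu)$ into $H_\rho$, the latter with the norm of $L^2([0,1],\rho)$, such that: 1. all polynomials $f$ lie in $L^2([0,1],\rho)\cap L^2([0,1],\rho^2/\mu)$ and satisfy $U_\rho(f)=\varphi f-T_\rho(f)$; more generally this formula holds for every $f\in L^2([0,1],\rho)\cap L^2([0,1],\rho^2/\mu)$ such that $\varphi f$ and $T_\rho(f)$ belong to $L^2([0,1],\rho)$; 2. $T_\rho(U_\rho(f))=\frac{\rho}{\mu}f$ in $L^2([0,1],\mu)$ for every $f\in L^2([0,1],\rho^2/\mu)$; 3. for all $f\in L^2([0,1],\rho^2/\mu)$ and $g\in L^2([0,1],\rho)$, the function $f\,T_\rho(g)\,\rho$ is integrable on $[0,1]$ and $\langle U_\rho(f),g\rangle_\rho=\int_0^1 f\,T_\rho(g)\,\rho\,dx$, that is, $\langle U_\rho f,g\rangle_\rho=\langle f,T_\rho g\rangle_\rho$. -/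

import Mathlib

open MeasureTheory Filter Set Topology

noncomputable section

/-- The measure `w(x) dx` on `[0,1]`. -/
def densityMeasure (w : ℝ → ℝ) : Measure ℝ :=
  (volume.restrict (Icc (0 : ℝ) 1)).withDensity (fun x => ENNReal.ofReal (w x))

/-- The real Hilbert space `L²([0,1], w)`. -/
abbrev WeightedL2 (w : ℝ → ℝ) : Type := Lp ℝ 2 (densityMeasure w)

/-- `ρ` is a probability density on `[0,1]`, continuous in the interior (it may blow up at the
end points, as `-log x` does). -/
structure IsContinuousProbDensity (ρ : ℝ → ℝ) : Prop where
  nonneg : ∀ x ∈ Ioo (0 : ℝ) 1, 0 ≤ ρ x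
  continuousOn : ContinuousOn ρ (Ioo 0 1)
  integrableOn : IntegrableOn ρ (Icc 0 1)
  integral_eq_one : ∫ t in Icc (0 : ℝ) 1, ρ t = 1

/-- Stieltjes transform `S_w(z) = ∫₀¹ w(t) / (z - t) dt`. -/
def stieltjesTransform (w : ℝ → ℝ) (z : ℂ) : ℂ :=
  ∫ t in Icc (0 : ℝ) 1, (w t : ℂ) / (z - (t : ℂ))

/-- The first moment `c₁ = ∫₀¹ t ρ(t) dt`. -/
def firstMoment (ρ : ℝ → ℝ) : ℝ := ∫ t in Icc (0 : ℝ) 1, t * ρ t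

/-- `μ` is a density on `[0,1]` of the secondary measure associated with `ρ`:
`S_μ(z) = z - c₁ - 1 / S_ρ(z)` for all complex `z` outside `[0,1]`. -/
structure IsSecondaryDensity (ρ μ : ℝ → ℝ) : Prop where
  nonneg : ∀ x ∈ Ioo (0 : ℝ) 1, 0 ≤ μ x
  integrableOn : IntegrableOn μ (Icc 0 1)
  stieltjes_eq : ∀ z : ℂ, z ∉ (fun t : ℝ => (t : ℂ)) '' Icc (0 : ℝ) 1 →
    stieltjesTransform μ z = z - (firstMoment ρ : ℂ) - 1 / stieltjesTransform ρ z

/-- The operator `f ↦ (x ↦ ∫₀¹ (f t - f x) / (t - x) ρ(t) dt)`, which sends a polynomial to its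
secondary polynomial. -/
def secondaryTransform (ρ f : ℝ → ℝ) (x : ℝ) : ℝ :=
  ∫ t in Icc (0 : ℝ) 1, (f t - f x) / (t - x) * ρ t

/-- `T` is a continuous linear extension of `secondaryTransform ρ` from the polynomials to all
of `L²([0,1], ρ)`, with values in `L²([0,1], μ)`. -/
def IsSecondaryExtension (ρ μ : ℝ → ℝ) (T : WeightedL2 ρ →L[ℝ] WeightedL2 μ) : Prop :=
  ∀ (p : Polynomial ℝ) (hp : MemLp (fun x => p.eval x) 2 (densityMeasure ρ)),
    T (hp.toLp (fun x => p.eval x)) =ᵐ[densityMeasure μ]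
      secondaryTransform ρ (fun x => p.eval x)

open Classical in
/-- The operator `T_ρ : L²([0,1], ρ) → L²([0,1], μ)`, the continuous linear extension of
`secondaryTransform ρ`. -/
def secondaryOperator (ρ μ : ℝ → ℝ) : WeightedL2 ρ →L[ℝ] WeightedL2 μ :=
  if h : ∃ T : WeightedL2 ρ →L[ℝ] WeightedL2 μ, IsSecondaryExtension ρ μ T then h.choose else 0

/-- The hyperplane `H_ρ` of `L²([0,1], ρ)`: the orthogonal complement of the constant `1`. -/
def orthHyperplane (ρ : ℝ → ℝ) : Submodule ℝ (WeightedL2 ρ) :=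
  (Submodule.span ℝ {e : WeightedL2 ρ | e =ᵐ[densityMeasure ρ] fun _ => (1 : ℝ)})ᗮ

/-- `2 ∫₀¹ (x - t) ρ(t) / ((x - t)² + ε²) dt`. -/
def reducerApprox (ρ : ℝ → ℝ) (ε x : ℝ) : ℝ :=
  2 * ∫ t in Icc (0 : ℝ) 1, (x - t) * ρ t / ((x - t) ^ 2 + ε ^ 2)

/-- The reducer `φ` of `ρ`: the pointwise limit of `reducerApprox ρ ε` as `ε → 0⁺`. -/
def reducer (ρ : ℝ → ℝ) (x : ℝ) : ℝ :=
  limUnder (𝓝[>] (0 : ℝ)) (fun ε => reducerApprox ρ ε x)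

/-- `ρ`, with secondary density `μ`, is reducible: the limit defining the reducer exists (almost
everywhere on `[0,1]`), it is also a limit in the norm of `L²([0,1], ρ)`, and `ρ / μ` belongs to
the image of `T_ρ`. -/
structure IsReducible (ρ μ : ℝ → ℝ) : Prop where
  exists_lim : ∀ᵐ x ∂(volume.restrict (Icc (0 : ℝ) 1)),
    ∃ l : ℝ, Tendsto (fun ε => reducerApprox ρ ε x) (𝓝[>] 0) (𝓝 l)
  tendsto_L2 : Tendsto
    (fun ε => eLpNorm (fun x => reducerApprox ρ ε x - reducer ρ x) 2 (densityMeasure ρ))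
    (𝓝[>] 0) (𝓝 0)
  quotient_mem_range : ∃ f : WeightedL2 ρ,
    secondaryOperator ρ μ f =ᵐ[densityMeasure μ] fun x => ρ x / μ x

end

/-! Write `T` for `secondaryOperator ρ μ`, `Q` for its restriction to polynomials, and `L`, `K` for
integration against `ρ`, `μ`. The isometry is `U f = T* ((ρ/μ) f)`, with `T*` the Hilbert adjoint.

Expanding the secondary relation at `z = 1/u` in powers of `u` yields a convolution identity between
the moments of `ρ` and `μ`. Induction with `Q (X p) = X Q p + L p` turns it into `K (Q p * Q q) = L
(p q) - L p * L q` (`moment_secondaryPolynomial_mul`). So `Q` extends to `T`, with `T* T` the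
orthogonal projection onto the hyperplane. As `Q` is onto, `T` has dense range and `T T* = 1`
(`secondaryOperator_adjoint`); thus `T*` is isometric into the hyperplane. Multiplication by `ρ/μ`
is isometric from `L²(ρ²/μ)` to `L²(μ)`, which gives the isometry and `T (U f) = (ρ/μ) f`.

The duality formula also needs `μ (ρ/μ) = ρ`, hence `μ ≠ 0` almost everywhere on `{ρ ≠ 0}`
(`ae_secondaryDensity_ne_zero`). The boundary behaviour of the secondary relation provides it: if
`μ` vanished on such a set, its Poisson integrals would tend to zero there in mean, whereas the
finite limit defining the reducer keeps them bounded below.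

For `U p = φ p - T p`, duality reduces the claim to `L (p Q q) + L (q Q p) = ∫ p q φ ρ`
(`IsReducible.moment_add_moment`), obtained by symmetrising a regularised double integral. General
`f` follows by approximating simultaneously in both weighted spaces. -/

noncomputable section

/-! ### Weights on `[0,1]` and integration against them. -/

/-- A weight on `[0,1]`: integrable, and non-negative in the interior. -/
structure IsWeight (w : ℝ → ℝ) : Prop where
  nonneg : ∀ x ∈ Ioo (0 : ℝ) 1, 0 ≤ w x
  integrableOn : IntegrableOn w (Icc 0 1)

theorem IsContinuousProbDensity.isWeight {ρ : ℝ → ℝ} (h : IsContinuousProbDensity ρ) :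
    IsWeight ρ := ⟨h.nonneg, h.integrableOn⟩

theorem IsSecondaryDensity.isWeight {ρ μ : ℝ → ℝ} (h : IsSecondaryDensity ρ μ) :
    IsWeight μ := ⟨h.nonneg, h.integrableOn⟩

theorem ae_Icc_mem_Ioo : ∀ᵐ x ∂(volume.restrict (Icc (0 : ℝ) 1)), x ∈ Ioo (0 : ℝ) 1 := by
  rw [← restrict_Ioo_eq_restrict_Icc]
  exact ae_restrict_mem measurableSet_Ioo

theorem densityMeasure_absolutelyContinuous (w : ℝ → ℝ) :
    densityMeasure w ≪ volume.restrict (Icc (0 : ℝ) 1) :=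
  withDensity_absolutelyContinuous _ _

theorem densityMeasure_compl_Icc (w : ℝ → ℝ) : densityMeasure w (Icc (0 : ℝ) 1)ᶜ = 0 :=
  densityMeasure_absolutelyContinuous w (by simp)

namespace IsWeight

variable {w : ℝ → ℝ}

theorem ae_nonneg (hw : IsWeight w) : ∀ᵐ x ∂(volume.restrict (Icc (0 : ℝ) 1)), 0 ≤ w x := by
  filter_upwards [ae_Icc_mem_Ioo] with x hx using hw.nonneg x hx

theorem isFiniteMeasure (hw : IsWeight w) : IsFiniteMeasure (densityMeasure w) :=
  isFiniteMeasure_withDensity_ofReal hw.integrableOn.2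

theorem aemeasurable_ofReal (hw : IsWeight w) :
    AEMeasurable (fun x => ENNReal.ofReal (w x)) (volume.restrict (Icc (0 : ℝ) 1)) :=
  hw.integrableOn.aemeasurable.ennreal_ofReal

theorem integral_eq (hw : IsWeight w) {E : Type*} [NormedAddCommGroup E] [NormedSpace ℝ E]
    (f : ℝ → E) : ∫ x, f x ∂(densityMeasure w) = ∫ x in Icc (0 : ℝ) 1, w x • f x := by
  rw [densityMeasure, integral_withDensity_eq_integral_toReal_smul₀ hw.aemeasurable_ofReal
    (by simp)]
  refine integral_congr_ae ?_
  filter_upwards [hw.ae_nonneg] with x hx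
  rw [ENNReal.toReal_ofReal hx]

theorem integrable_iff (hw : IsWeight w) {E : Type*} [NormedAddCommGroup E] [NormedSpace ℝ E]
    (f : ℝ → E) : Integrable f (densityMeasure w) ↔
      IntegrableOn (fun x => w x • f x) (Icc (0 : ℝ) 1) := by
  have h1 : densityMeasure w =
      (volume.restrict (Icc (0 : ℝ) 1)).withDensity (fun x => ((w x).toNNReal : ENNReal)) := rfl
  rw [h1, integrable_withDensity_iff_integrable_smul₀
    hw.integrableOn.aemeasurable.real_toNNReal]
  refine integrable_congr ?_
  filter_upwards [hw.ae_nonneg] with x hx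
  rw [NNReal.smul_def, Real.coe_toNNReal _ hx]

theorem ae_iff (hw : IsWeight w) {p : ℝ → Prop} : (∀ᵐ x ∂(densityMeasure w), p x) ↔
    ∀ᵐ x ∂(volume.restrict (Icc (0 : ℝ) 1)), w x ≠ 0 → p x := by
  rw [densityMeasure, ae_withDensity_iff' hw.aemeasurable_ofReal]
  refine eventually_congr ?_
  filter_upwards [hw.ae_nonneg] with x hx
  have : ENNReal.ofReal (w x) ≠ 0 ↔ w x ≠ 0 := by
    rw [Ne, ENNReal.ofReal_eq_zero, not_le]
    exact ⟨fun h => h.ne', fun h => lt_of_le_of_ne hx (Ne.symm h)⟩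
  rw [this]

theorem lintegral_eq (hw : IsWeight w) {f : ℝ → ENNReal}
    (hf : AEMeasurable f (densityMeasure w)) :
    ∫⁻ x, f x ∂(densityMeasure w) = ∫⁻ x in Icc (0 : ℝ) 1, ENNReal.ofReal (w x) * f x := by
  rw [densityMeasure, lintegral_withDensity_eq_lintegral_mul₀' hw.aemeasurable_ofReal hf]
  rfl

end IsWeight

/-! ### Density of polynomials in `L²` of a finite measure carried by `[0,1]`. -/

section PolynomialDensity

variable {ν : Measure ℝ} [IsFiniteMeasure ν]

theorem memLp_of_continuousOn_Icc (hν : ν (Icc (0 : ℝ) 1)ᶜ = 0) {f : ℝ → ℝ}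
    (hf : ContinuousOn f (Icc 0 1)) (q : ENNReal) : MemLp f q ν := by
  have hres : ν.restrict (Icc (0 : ℝ) 1) = ν := Measure.restrict_eq_self_of_ae_mem hν
  obtain ⟨C, hC⟩ := isCompact_Icc.exists_bound_of_continuousOn hf
  refine MemLp.of_bound ?_ C ?_
  · rw [← hres]
    exact hf.aestronglyMeasurable measurableSet_Icc
  · filter_upwards [show ∀ᵐ x ∂ν, x ∈ Icc (0 : ℝ) 1 from hν] with x hx using hC x hx

theorem memLp_polynomial (hν : ν (Icc (0 : ℝ) 1)ᶜ = 0) (p : Polynomial ℝ) (q : ENNReal) :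
    MemLp (fun x => p.eval x) q ν :=
  memLp_of_continuousOn_Icc hν p.continuous.continuousOn q

theorem integrable_polynomial (hν : ν (Icc (0 : ℝ) 1)ᶜ = 0) (p : Polynomial ℝ) :
    Integrable (fun x => p.eval x) ν :=
  memLp_one_iff_integrable.1 (memLp_polynomial hν p 1)

/-- Bounded continuous functions are dense, and Weierstrass approximates them uniformly on `[0,1]`.
The measure is left general because a sum of two weighted measures is needed later. -/
theorem MeasureTheory.MemLp.exists_polynomial_eLpNorm_sub_le (hν : ν (Icc (0 : ℝ) 1)ᶜ = 0)
    {f : ℝ → ℝ} (hf : MemLp f 2 ν) {ε : ENNReal} (hε : ε ≠ 0) :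
    ∃ p : Polynomial ℝ, eLpNorm (fun x => f x - p.eval x) 2 ν ≤ ε := by
  rcases eq_or_ne ε ⊤ with rfl | hεt
  · exact ⟨0, le_top⟩
  have hε2 : ε / 2 ≠ 0 := (ENNReal.half_pos hε).ne'
  obtain ⟨g, hg, hgL⟩ := hf.exists_boundedContinuous_eLpNorm_sub_le (by simp) hε2
  -- `M` is the factor `ν(univ)^(1/2)` by which a uniform bound controls the `L²` norm.
  set M : ENNReal := ν univ ^ ((2 : ENNReal).toReal)⁻¹ with hM
  have hMt : M ≠ ⊤ := ENNReal.rpow_ne_top_of_nonneg (by positivity) (measure_ne_top _ _)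
  obtain ⟨δ, hδ0, hδ⟩ : ∃ δ : ℝ, 0 < δ ∧ M * ENNReal.ofReal δ ≤ ε / 2 := by
    have ht : Tendsto (fun δ : ℝ => M * ENNReal.ofReal δ) (𝓝[>] 0) (𝓝 0) := by
      have := (ENNReal.Tendsto.const_mul (a := M) (ENNReal.tendsto_ofReal
        (tendsto_id (α := ℝ) (x := 𝓝 0))) (Or.inr hMt))
      simp only [ENNReal.ofReal_zero, mul_zero, id] at this
      exact this.mono_left nhdsWithin_le_nhds
    have h1 := ht.eventually (gt_mem_nhds (ENNReal.half_pos hε))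
    obtain ⟨δ, h2, h3⟩ := (h1.and self_mem_nhdsWithin).exists
    exact ⟨δ, h3, h2.le⟩
  obtain ⟨p, hp⟩ := exists_polynomial_near_of_continuousOn 0 1 g g.continuous.continuousOn δ hδ0
  refine ⟨p, ?_⟩
  have hgp : eLpNorm (fun x => g x - p.eval x) 2 ν ≤ ε / 2 := by
    refine (eLpNorm_le_of_ae_bound (C := δ) ?_).trans hδ
    filter_upwards [show ∀ᵐ x ∂ν, x ∈ Icc (0 : ℝ) 1 from hν] with x hx
    rw [norm_sub_rev]
    exact (hp x hx).le
  have hsum : (fun x => f x - p.eval x) = (f - ⇑g) + fun x => g x - p.eval x := by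
    ext x; simp
  rw [hsum, ← ENNReal.add_halves ε]
  refine (eLpNorm_add_le (hf.sub hgL).1 (hgL.sub (memLp_polynomial hν p 2)).1 (by simp)).trans ?_
  exact add_le_add hg hgp

/-- Polynomials, as elements of `L²(ν)` for a finite measure `ν` carried by `[0,1]`. -/
def polynomialToLp (hν : ν (Icc (0 : ℝ) 1)ᶜ = 0) : Polynomial ℝ →ₗ[ℝ] Lp ℝ 2 ν where
  toFun p := (memLp_polynomial hν p 2).toLp _
  map_add' p q := by
    rw [← MemLp.toLp_add]
    congr 1
    ext x
    simp
  map_smul' c p := by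
    rw [RingHom.id_apply, ← MemLp.toLp_const_smul]
    congr 1
    ext x
    simp

theorem coeFn_polynomialToLp (hν : ν (Icc (0 : ℝ) 1)ᶜ = 0) (p : Polynomial ℝ) :
    polynomialToLp hν p =ᵐ[ν] fun x => p.eval x :=
  MemLp.coeFn_toLp (memLp_polynomial hν p 2)

theorem inner_polynomialToLp_left (hν : ν (Icc (0 : ℝ) 1)ᶜ = 0) (p : Polynomial ℝ)
    (f : Lp ℝ 2 ν) : inner ℝ (polynomialToLp hν p) f = ∫ x, p.eval x * f x ∂ν := by
  rw [L2.inner_def]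
  refine integral_congr_ae ?_
  filter_upwards [coeFn_polynomialToLp hν p] with x hx
  simp [hx, mul_comm]

theorem inner_polynomialToLp (hν : ν (Icc (0 : ℝ) 1)ᶜ = 0) (p q : Polynomial ℝ) :
    inner ℝ (polynomialToLp hν p) (polynomialToLp hν q) = ∫ x, (p * q).eval x ∂ν := by
  rw [inner_polynomialToLp_left]
  refine integral_congr_ae ?_
  filter_upwards [coeFn_polynomialToLp hν q] with x hx
  rw [hx, Polynomial.eval_mul]

theorem denseRange_polynomialToLp (hν : ν (Icc (0 : ℝ) 1)ᶜ = 0) :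
    DenseRange (polynomialToLp hν) := by
  intro f
  rw [EMetric.mem_closure_iff]
  intro ε hε
  obtain ⟨p, hp⟩ := (Lp.memLp f).exists_polynomial_eLpNorm_sub_le hν (ENNReal.half_pos hε.ne').ne'
  rcases eq_or_ne ε ⊤ with rfl | hεt
  · exact ⟨_, ⟨p, rfl⟩, edist_lt_top _ _⟩
  refine ⟨_, ⟨p, rfl⟩, ?_⟩
  rw [Lp.edist_def]
  refine lt_of_le_of_lt ?_ (ENNReal.half_lt_self hε.ne' hεt)
  refine le_trans (le_of_eq (eLpNorm_congr_ae ?_)) hp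
  filter_upwards [coeFn_polynomialToLp hν p] with x hx
  simp [hx]

end PolynomialDensity

/-! ### Moments, their generating series, and secondary polynomials. -/

/-- The linear functional `p ↦ ∫ p dν`. -/
def momentFunctional (ν : Measure ℝ) [IsFiniteMeasure ν] (hν : ν (Icc (0 : ℝ) 1)ᶜ = 0) :
    Polynomial ℝ →ₗ[ℝ] ℝ where
  toFun p := ∫ x, p.eval x ∂ν
  map_add' p q := by
    simp only [Polynomial.eval_add]
    exact integral_add (integrable_polynomial hν p) (integrable_polynomial hν q)
  map_smul' c p := by
    simp only [Polynomial.eval_smul, smul_eq_mul, RingHom.id_apply]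
    exact integral_const_mul _ _

theorem coeff_eq_zero_of_hasSum {d : ℕ → ℝ}
    (h : ∀ u : ℝ, u ≠ 0 → |u| < 1 → HasSum (fun n => u ^ n * d n) 0) (n : ℕ) : d n = 0 := by
  -- The hypothesis says nothing at `u = 0`, which stands for `z = ∞`. Multiplying the series by `u`
  -- shifts the coefficients and makes the sum vanish there too, so uniqueness of power series
  -- applies.
  let e : ℕ → ℝ := fun n => Nat.casesOn n 0 d
  have he : HasFPowerSeriesAt (0 : ℝ → ℝ) (FormalMultilinearSeries.ofScalars ℝ e) 0 := by
    rw [hasFPowerSeriesAt_iff]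
    filter_upwards [Metric.ball_mem_nhds (0 : ℝ) one_pos] with u hu
    simp only [FormalMultilinearSeries.coeff_ofScalars, smul_eq_mul, Pi.zero_apply]
    rw [← hasSum_nat_add_iff' 1]
    have h0 : (0 : ℝ) - ∑ i ∈ Finset.range 1, u ^ i * e i = u * 0 := by simp [e]
    rw [h0]
    have hterm : ∀ n, u ^ (n + 1) * e (n + 1) = u * (u ^ n * d n) := fun n => by
      change u ^ (n + 1) * d n = _
      rw [pow_succ']
      ring
    simp only [hterm]
    rcases eq_or_ne u 0 with rfl | hu0
    · simp
    · exact (h u hu0 (by simpa using hu)).mul_left u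
  have h1 := he.eq_zero
  have h2 : (FormalMultilinearSeries.ofScalars ℝ e).coeff (n + 1) = 0 := by rw [h1]; rfl
  simpa [FormalMultilinearSeries.coeff_ofScalars, e] using h2

namespace IsWeight

variable {w : ℝ → ℝ}

/-- The moment functional `p ↦ ∫₀¹ p w` of a weight. -/
def moment (hw : IsWeight w) : Polynomial ℝ →ₗ[ℝ] ℝ :=
  haveI := hw.isFiniteMeasure
  momentFunctional (densityMeasure w) (densityMeasure_compl_Icc w)

theorem moment_apply (hw : IsWeight w) (p : Polynomial ℝ) :
    hw.moment p = ∫ x, p.eval x ∂(densityMeasure w) := rfl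

theorem hasSum_moment (hw : IsWeight w) {u : ℝ} (hu : |u| < 1) :
    HasSum (fun n => u ^ n * hw.moment (Polynomial.X ^ n))
      (∫ x, (1 - u * x)⁻¹ ∂(densityMeasure w)) := by
  have := hw.isFiniteMeasure
  have hmem : ∀ᵐ x ∂(densityMeasure w), x ∈ Icc (0 : ℝ) 1 := densityMeasure_compl_Icc w
  have := hasSum_integral_of_dominated_convergence (μ := densityMeasure w)
    (F := fun n x => u ^ n * x ^ n) (f := fun x => (1 - u * x)⁻¹) (fun n _ => |u| ^ n)
    (fun n => by fun_prop) ?_ ?_ ?_ ?_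
  · simpa [moment_apply, integral_const_mul] using this
  · intro n
    filter_upwards [hmem] with x hx
    rw [norm_mul, norm_pow, norm_pow, Real.norm_eq_abs, Real.norm_eq_abs, abs_of_nonneg hx.1]
    exact mul_le_of_le_one_right (by positivity) (pow_le_one₀ hx.1 hx.2)
  · exact Eventually.of_forall fun x => summable_geometric_of_lt_one (abs_nonneg u) hu
  · exact integrable_const _
  · filter_upwards [hmem] with x hx
    simp only [← mul_pow]
    refine hasSum_geometric_of_abs_lt_one ?_
    rw [abs_mul, abs_of_nonneg hx.1]
    exact (mul_le_of_le_one_right (abs_nonneg u) hx.2).trans_lt hu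

theorem stieltjesTransform_inv (hw : IsWeight w) {u : ℝ} (hu : u ≠ 0) :
    stieltjesTransform w ((u⁻¹ : ℝ) : ℂ) =
      ((u * ∫ x, (1 - u * x)⁻¹ ∂(densityMeasure w) : ℝ) : ℂ) := by
  rw [hw.integral_eq, ← integral_const_mul, stieltjesTransform,
    ← integral_complex_ofReal]
  refine integral_congr_ae (Eventually.of_forall fun t => ?_)
  have : u⁻¹ - t = u⁻¹ * (1 - u * t) := by field_simp
  simp only [smul_eq_mul]
  rw [← Complex.ofReal_sub, this, ← Complex.ofReal_div]
  congr 1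
  rw [div_eq_mul_inv, mul_inv, inv_inv]
  ring

/-- On the diagonal `t = x` the quotient is `0 / 0 = 0` and not the derivative; the single point is
null for the weighted measure. -/
theorem ae_divByMonic (x : ℝ) (p : Polynomial ℝ) : ∀ᵐ t ∂(densityMeasure w),
    (p.eval t - p.eval x) / (t - x) = (p /ₘ (Polynomial.X - Polynomial.C x)).eval t := by
  refine (densityMeasure_absolutelyContinuous w).ae_le (ae_restrict_of_ae ?_)
  filter_upwards [Measure.ae_ne volume x] with t ht
  rw [div_eq_iff (sub_ne_zero.2 ht)]
  have h := congrArg (Polynomial.eval t) (Polynomial.X_sub_C_mul_divByMonic_eq_sub_modByMonic p x)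
  rw [Polynomial.modByMonic_X_sub_C_eq_C_eval] at h
  simp only [Polynomial.eval_mul, Polynomial.eval_sub, Polynomial.eval_X, Polynomial.eval_C] at h
  rw [← h, mul_comm]

theorem secondaryTransform_eq (hw : IsWeight w) (f : ℝ → ℝ) (x : ℝ) :
    secondaryTransform w f x = ∫ t, (f t - f x) / (t - x) ∂(densityMeasure w) := by
  rw [hw.integral_eq]
  simp only [smul_eq_mul, mul_comm, secondaryTransform]

theorem integrable_diffQuot (hw : IsWeight w) (x : ℝ) (p : Polynomial ℝ) :
    Integrable (fun t => (p.eval t - p.eval x) / (t - x)) (densityMeasure w) := by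
  have := hw.isFiniteMeasure
  exact (integrable_polynomial (densityMeasure_compl_Icc w) _).congr
    ((ae_divByMonic x p).mono fun _ h => h.symm)

theorem secondaryTransform_add (hw : IsWeight w) (p q : Polynomial ℝ) (x : ℝ) :
    secondaryTransform w (fun t => (p + q).eval t) x =
      secondaryTransform w (fun t => p.eval t) x + secondaryTransform w (fun t => q.eval t) x := by
  rw [hw.secondaryTransform_eq, hw.secondaryTransform_eq, hw.secondaryTransform_eq,
    ← integral_add (hw.integrable_diffQuot x p) (hw.integrable_diffQuot x q)]
  congr 1 with t
  rw [Polynomial.eval_add, Polynomial.eval_add]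
  ring

theorem secondaryTransform_smul (c : ℝ) (p : Polynomial ℝ) (x : ℝ) :
    secondaryTransform w (fun t => (c • p).eval t) x =
      c * secondaryTransform w (fun t => p.eval t) x := by
  rw [secondaryTransform, secondaryTransform, ← integral_const_mul]
  congr 1 with t
  rw [Polynomial.eval_smul, Polynomial.eval_smul, smul_eq_mul, smul_eq_mul]
  ring

/-- Integrate `(t p(t) - x p(x)) / (t - x) = x (p(t) - p(x)) / (t - x) + p(t)`. All later
recurrences come from this. -/
theorem secondaryTransform_X_mul (hw : IsWeight w) (p : Polynomial ℝ) (x : ℝ) :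
    secondaryTransform w (fun t => (Polynomial.X * p).eval t) x =
      x * secondaryTransform w (fun t => p.eval t) x + hw.moment p := by
  have := hw.isFiniteMeasure
  rw [hw.secondaryTransform_eq, hw.secondaryTransform_eq, moment_apply, ← integral_const_mul,
    ← integral_add ((hw.integrable_diffQuot x p).const_mul x)
      (integrable_polynomial (densityMeasure_compl_Icc w) p)]
  refine integral_congr_ae ((densityMeasure_absolutelyContinuous w).ae_le (ae_restrict_of_ae ?_))
  filter_upwards [Measure.ae_ne volume x] with t ht
  have := sub_ne_zero.2 ht
  simp only [Polynomial.eval_mul, Polynomial.eval_X]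
  field_simp
  ring

theorem secondaryTransform_one (x : ℝ) :
    secondaryTransform w (fun t => (1 : Polynomial ℝ).eval t) x = 0 := by
  simp [secondaryTransform]

theorem exists_secondaryPolynomial (hw : IsWeight w) (p : Polynomial ℝ) :
    ∃ q : Polynomial ℝ, ∀ x, q.eval x = secondaryTransform w (fun t => p.eval t) x := by
  induction p using Polynomial.induction_on' with
  | add p q hp hq =>
    obtain ⟨p', hp⟩ := hp
    obtain ⟨q', hq⟩ := hq
    exact ⟨p' + q', fun x => by rw [hw.secondaryTransform_add, ← hp, ← hq, Polynomial.eval_add]⟩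
  | monomial n a =>
    suffices H : ∃ q : Polynomial ℝ, ∀ x,
        q.eval x = secondaryTransform w (fun t => (Polynomial.X ^ n : Polynomial ℝ).eval t) x by
      obtain ⟨q, hq⟩ := H
      refine ⟨a • q, fun x => ?_⟩
      rw [← Polynomial.smul_X_eq_monomial, secondaryTransform_smul, ← hq, Polynomial.eval_smul,
        smul_eq_mul]
    induction n with
    | zero => exact ⟨0, fun x => by rw [pow_zero, secondaryTransform_one, Polynomial.eval_zero]⟩
    | succ n ih =>
      obtain ⟨q, hq⟩ := ih
      refine ⟨Polynomial.X * q + Polynomial.C (hw.moment (Polynomial.X ^ n)), fun x => ?_⟩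
      rw [pow_succ', hw.secondaryTransform_X_mul, ← hq]
      simp

/-- The operator sending a polynomial to its secondary polynomial. -/
def secondaryPolynomial (hw : IsWeight w) : Polynomial ℝ →ₗ[ℝ] Polynomial ℝ where
  toFun p := (hw.exists_secondaryPolynomial p).choose
  map_add' p q := Polynomial.funext fun x => by
    rw [Polynomial.eval_add, (hw.exists_secondaryPolynomial _).choose_spec,
      (hw.exists_secondaryPolynomial _).choose_spec,
      (hw.exists_secondaryPolynomial _).choose_spec, hw.secondaryTransform_add]
  map_smul' c p := Polynomial.funext fun x => by
    rw [RingHom.id_apply, Polynomial.eval_smul, (hw.exists_secondaryPolynomial _).choose_spec,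
      (hw.exists_secondaryPolynomial _).choose_spec, secondaryTransform_smul, smul_eq_mul]

theorem eval_secondaryPolynomial (hw : IsWeight w) (p : Polynomial ℝ) (x : ℝ) :
    (hw.secondaryPolynomial p).eval x = secondaryTransform w (fun t => p.eval t) x :=
  (hw.exists_secondaryPolynomial p).choose_spec x

theorem secondaryPolynomial_one (hw : IsWeight w) : hw.secondaryPolynomial 1 = 0 :=
  Polynomial.funext fun x => by
    rw [eval_secondaryPolynomial, secondaryTransform_one, Polynomial.eval_zero]

theorem secondaryPolynomial_X_mul (hw : IsWeight w) (p : Polynomial ℝ) :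
    hw.secondaryPolynomial (Polynomial.X * p) =
      Polynomial.X * hw.secondaryPolynomial p + Polynomial.C (hw.moment p) :=
  Polynomial.funext fun x => by
    rw [eval_secondaryPolynomial, hw.secondaryTransform_X_mul, ← eval_secondaryPolynomial hw]
    simp

/-- The antidiagonal form is chosen to match the Cauchy product of two moment series. -/
theorem secondaryPolynomial_X_pow_succ (hw : IsWeight w) (n : ℕ) :
    hw.secondaryPolynomial (Polynomial.X ^ (n + 1)) =
      ∑ ij ∈ Finset.HasAntidiagonal.antidiagonal n, hw.moment (Polynomial.X ^ ij.2) • Polynomial.X ^ ij.1 := by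
  induction n with
  | zero =>
    rw [pow_succ', secondaryPolynomial_X_mul, pow_zero, secondaryPolynomial_one]
    simp [Polynomial.smul_eq_C_mul]
  | succ n ih =>
    rw [pow_succ', secondaryPolynomial_X_mul, ih, Finset.Nat.antidiagonal_succ, Finset.mul_sum,
      add_comm, Finset.sum_cons, Finset.sum_map]
    congr 1
    · simp [Polynomial.smul_eq_C_mul]
    · refine Finset.sum_congr rfl fun ij _ => ?_
      rw [mul_smul_comm, ← pow_succ']
      rfl

/-- Total mass one sends `X` to `1`, so constants are reached; multiplying a preimage by `X` gives a
preimage of `X` times the target, up to a constant that can be corrected. -/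
theorem secondaryPolynomial_surjective (hw : IsWeight w) (h1 : hw.moment 1 = 1) :
    Function.Surjective hw.secondaryPolynomial := by
  have hC : ∀ c : ℝ, ∃ p, hw.secondaryPolynomial p = Polynomial.C c := fun c =>
    ⟨c • Polynomial.X, by
      rw [map_smul, ← mul_one Polynomial.X, secondaryPolynomial_X_mul, secondaryPolynomial_one, h1]
      simp [Polynomial.smul_eq_C_mul]⟩
  intro q
  induction q using Polynomial.induction_on with
  | C a => exact hC a
  | add p q hp hq =>
    obtain ⟨p', rfl⟩ := hp
    obtain ⟨q', rfl⟩ := hq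
    exact ⟨p' + q', map_add _ _ _⟩
  | monomial n a ih =>
    obtain ⟨p, hp⟩ := ih
    obtain ⟨r, hr⟩ := hC (hw.moment p)
    refine ⟨Polynomial.X * p - r, ?_⟩
    rw [map_sub, secondaryPolynomial_X_mul, hp, hr]
    ring

end IsWeight

/-! ### The inner product identity for secondary polynomials. -/

section Isometry

variable {ρ μ : ℝ → ℝ}

theorem IsContinuousProbDensity.moment_one (hρ : IsContinuousProbDensity ρ) :
    hρ.isWeight.moment 1 = 1 := by
  rw [IsWeight.moment_apply, hρ.isWeight.integral_eq]
  simpa using hρ.integral_eq_one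

theorem IsWeight.moment_X (hρ : IsWeight ρ) : hρ.moment Polynomial.X = firstMoment ρ := by
  rw [IsWeight.moment_apply, hρ.integral_eq]
  simp [firstMoment, mul_comm]

/-- Ensures that the Stieltjes transform of `ρ` does not vanish at `1/u`. The lower bound `1/2`
comes from `1 - u x ≤ 2`. -/
theorem IsContinuousProbDensity.integral_inv_pos (hρ : IsContinuousProbDensity ρ) {u : ℝ}
    (hu : |u| < 1) : 0 < ∫ x, (1 - u * x)⁻¹ ∂(densityMeasure ρ) := by
  have := hρ.isWeight.isFiniteMeasure
  have hu' := abs_lt.1 hu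
  have hpos : ∀ x ∈ Icc (0 : ℝ) 1, 0 < 1 - u * x := fun x hx => by
    nlinarith [hx.1, hx.2, mul_nonneg hx.1 (sub_nonneg.2 hu'.2.le)]
  have h1 : ∫ x, (1 / 2 : ℝ) ∂(densityMeasure ρ) = 1 / 2 := by
    have := hρ.moment_one
    rw [IsWeight.moment_apply] at this
    simp only [Polynomial.eval_one] at this
    have h2 : ∫ x, (1 / 2 : ℝ) ∂(densityMeasure ρ) = (1 / 2) * ∫ x, (1 : ℝ) ∂(densityMeasure ρ) := by
      rw [← integral_const_mul]; simp
    rw [h2, this, mul_one]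
  have h2 : ∫ x, (1 / 2 : ℝ) ∂(densityMeasure ρ) ≤ ∫ x, (1 - u * x)⁻¹ ∂(densityMeasure ρ) := by
    refine integral_mono_ae (integrable_const _) ?_ ?_
    · refine memLp_one_iff_integrable.1 (memLp_of_continuousOn_Icc (densityMeasure_compl_Icc ρ) ?_ 1)
      exact ContinuousOn.inv₀ (by fun_prop) fun x hx => (hpos x hx).ne'
    · filter_upwards [show ∀ᵐ x ∂(densityMeasure ρ), x ∈ Icc (0 : ℝ) 1 from
        densityMeasure_compl_Icc ρ] with x hx
      rw [one_div]
      refine inv_anti₀ (hpos x hx) ?_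
      nlinarith [hx.1, hx.2, mul_nonneg hx.1 (by linarith : 0 ≤ 1 + u)]
  linarith

/-- Compare coefficients in `S_μ S_ρ = (z - c₁) S_ρ - 1` at `z = 1/u`; dividing by `u²` removes the
terms of degree zero and one on the right, which match `m 0 = 1` and `m 1 = c₁`. -/
theorem sum_antidiagonal_moment (hρ : IsContinuousProbDensity ρ) (hμ : IsSecondaryDensity ρ μ)
    (n : ℕ) :
    ∑ ij ∈ Finset.HasAntidiagonal.antidiagonal n, hμ.isWeight.moment (Polynomial.X ^ ij.1) *
        hρ.isWeight.moment (Polynomial.X ^ ij.2) =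
      hρ.isWeight.moment (Polynomial.X ^ (n + 2)) -
        firstMoment ρ * hρ.isWeight.moment (Polynomial.X ^ (n + 1)) := by
  set m : ℕ → ℝ := fun n => hρ.isWeight.moment (Polynomial.X ^ n) with hm
  set s : ℕ → ℝ := fun n => hμ.isWeight.moment (Polynomial.X ^ n) with hs
  have hm0 : m 0 = 1 := by simpa [hm] using hρ.moment_one
  have hm1 : m 1 = firstMoment ρ := by simpa [hm] using hρ.isWeight.moment_X
  have key := coeff_eq_zero_of_hasSum (d := fun n => ∑ ij ∈ Finset.HasAntidiagonal.antidiagonal n, s ij.1 * m ij.2 -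
    (m (n + 2) - firstMoment ρ * m (n + 1))) ?_ n
  · exact sub_eq_zero.1 key
  intro u hu0 hu
  set M := ∫ x, (1 - u * x)⁻¹ ∂(densityMeasure ρ) with hM
  set N := ∫ x, (1 - u * x)⁻¹ ∂(densityMeasure μ) with hN
  have hMsum : HasSum (fun n => u ^ n * m n) M := hρ.isWeight.hasSum_moment hu
  have hNsum : HasSum (fun n => u ^ n * s n) N := hμ.isWeight.hasSum_moment hu
  have hMpos : 0 < M := hρ.integral_inv_pos hu
  have hrel : u ^ 2 * (N * M) = M - firstMoment ρ * u * M - 1 := by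
    have h := hμ.stieltjes_eq ((u⁻¹ : ℝ) : ℂ) (by
      rintro ⟨t, ht, hte⟩
      have h1 : t = u⁻¹ := Complex.ofReal_injective hte
      have h2 : 1 < |u⁻¹| := by rw [abs_inv]; exact (one_lt_inv₀ (abs_pos.2 hu0)).2 hu
      rw [← h1, abs_of_nonneg ht.1] at h2
      linarith [ht.2])
    rw [hμ.isWeight.stieltjesTransform_inv hu0, hρ.isWeight.stieltjesTransform_inv hu0] at h
    have h' : u * N = u⁻¹ - firstMoment ρ - 1 / (u * M) := by exact_mod_cast h
    have hM0 := hMpos.ne'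
    field_simp at h'
    linear_combination h'
  have hA : HasSum (fun n => u ^ n * ∑ ij ∈ Finset.HasAntidiagonal.antidiagonal n, s ij.1 * m ij.2) (N * M) := by
    have hsum := summable_norm_sum_mul_antidiagonal_of_summable_norm hNsum.summable.norm
      hMsum.summable.norm
    have := tsum_mul_tsum_eq_tsum_sum_antidiagonal_of_summable_norm hNsum.summable.norm
      hMsum.summable.norm
    rw [hNsum.tsum_eq, hMsum.tsum_eq] at this
    rw [this]
    refine (congrArg (fun f : ℕ → ℝ => HasSum f _) (funext fun n => ?_)).mp hsum.of_norm.hasSum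
    rw [Finset.mul_sum]
    refine Finset.sum_congr rfl fun ij hij => ?_
    rw [← Finset.HasAntidiagonal.mem_antidiagonal.1 hij, pow_add]
    ring
  have hB : HasSum (fun n => u ^ n * m (n + 1)) ((M - 1) / u) := by
    have h1 := ((hasSum_nat_add_iff' 1).2 hMsum).div_const u
    simp only [Finset.range_one, Finset.sum_singleton, pow_zero, hm0, mul_one] at h1
    refine (congrArg (fun f : ℕ → ℝ => HasSum f _) (funext fun n => ?_)).mp h1
    rw [pow_succ]
    field_simp
  have hC : HasSum (fun n => u ^ n * m (n + 2)) ((M - (1 + u * firstMoment ρ)) / u ^ 2) := by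
    have h1 := ((hasSum_nat_add_iff' 2).2 hMsum).div_const (u ^ 2)
    simp only [Finset.sum_range_succ, Finset.range_zero, Finset.sum_empty, pow_zero, hm0, hm1,
      pow_one, one_mul, zero_add] at h1
    refine (congrArg (fun f : ℕ → ℝ => HasSum f _) (funext fun n => ?_)).mp h1
    rw [pow_add]
    field_simp
  have := hA.sub (hC.sub (hB.mul_left (firstMoment ρ)))
  have hval : N * M - ((M - (1 + u * firstMoment ρ)) / u ^ 2 - firstMoment ρ * ((M - 1) / u)) =
      0 := by
    field_simp
    linear_combination hrel
  rw [hval] at this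
  refine (congrArg (fun f : ℕ → ℝ => HasSum f _) (funext fun n => ?_)).mp this
  ring

/-- The case `q = X` of `moment_secondaryPolynomial_mul`, isolated because the induction there
relies on it. -/
theorem moment_secondaryPolynomial (hρ : IsContinuousProbDensity ρ) (hμ : IsSecondaryDensity ρ μ)
    (p : Polynomial ℝ) :
    hμ.isWeight.moment (hρ.isWeight.secondaryPolynomial p) =
      hρ.isWeight.moment (Polynomial.X * p) - firstMoment ρ * hρ.isWeight.moment p := by
  induction p using Polynomial.induction_on' with
  | add p q hp hq =>
    rw [map_add, map_add, hp, hq, mul_add, map_add, map_add]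
    ring
  | monomial n a =>
    rw [← Polynomial.smul_X_eq_monomial, map_smul, map_smul, mul_smul_comm, map_smul, map_smul,
      smul_eq_mul, smul_eq_mul, smul_eq_mul]
    have : hμ.isWeight.moment (hρ.isWeight.secondaryPolynomial (Polynomial.X ^ n)) =
        hρ.isWeight.moment (Polynomial.X * Polynomial.X ^ n) -
          firstMoment ρ * hρ.isWeight.moment (Polynomial.X ^ n) := by
      cases n with
      | zero =>
        rw [pow_zero, IsWeight.secondaryPolynomial_one, map_zero, mul_one, hρ.moment_one,
          IsWeight.moment_X]
        ring
      | succ n =>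
        rw [IsWeight.secondaryPolynomial_X_pow_succ, map_sum, ← pow_succ',
          ← sum_antidiagonal_moment hρ hμ n]
        refine Finset.sum_congr rfl fun ij _ => ?_
        rw [map_smul, smul_eq_mul, mul_comm]
    rw [this]
    ring

/-- The secondary polynomial operator preserves inner products, up to the component along `1`. -/
theorem moment_secondaryPolynomial_mul (hρ : IsContinuousProbDensity ρ)
    (hμ : IsSecondaryDensity ρ μ) (p q : Polynomial ℝ) :
    hμ.isWeight.moment (hρ.isWeight.secondaryPolynomial p * hρ.isWeight.secondaryPolynomial q) =
      hρ.isWeight.moment (p * q) - hρ.isWeight.moment p * hρ.isWeight.moment q := by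
  set Q := hρ.isWeight.secondaryPolynomial
  set L := hρ.isWeight.moment
  set K := hμ.isWeight.moment
  have hpow : ∀ (n : ℕ) (q : Polynomial ℝ), K (Q (Polynomial.X ^ n) * Q q) =
      L (Polynomial.X ^ n * q) - L (Polynomial.X ^ n) * L q := by
    intro n
    induction n with
    | zero =>
      intro q
      rw [pow_zero, hρ.isWeight.secondaryPolynomial_one, zero_mul, map_zero, one_mul,
        hρ.moment_one]
      ring
    | succ n ih =>
      intro q
      have h1 := ih (Polynomial.X * q)
      have h2 := moment_secondaryPolynomial hρ hμ (Polynomial.X ^ n)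
      have h3 := moment_secondaryPolynomial hρ hμ q
      rw [pow_succ']
      -- One factor `X` moves from the first argument to the second, which is why the induction
      -- keeps `q` arbitrary. The two correction terms are known from `h2` and `h3`, and their
      -- `firstMoment ρ` parts cancel.
      have e1 : Q (Polynomial.X * Polynomial.X ^ n) * Q q =
          Q (Polynomial.X ^ n) * Q (Polynomial.X * q) + L (Polynomial.X ^ n) • Q q
            - L q • Q (Polynomial.X ^ n) := by
        rw [hρ.isWeight.secondaryPolynomial_X_mul, hρ.isWeight.secondaryPolynomial_X_mul,
          Polynomial.smul_eq_C_mul, Polynomial.smul_eq_C_mul]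
        ring
      have e2 : Polynomial.X * Polynomial.X ^ n * q = Polynomial.X ^ n * (Polynomial.X * q) := by
        ring
      rw [e1, e2, map_sub, map_add, map_smul, map_smul, smul_eq_mul, smul_eq_mul, h1, h2, h3]
      ring
  induction p using Polynomial.induction_on' with
  | add p r hp hr =>
    rw [map_add, add_mul, add_mul, map_add, map_add, map_add, hp, hr]
    ring
  | monomial n a =>
    rw [← Polynomial.smul_X_eq_monomial, map_smul, smul_mul_assoc, smul_mul_assoc, map_smul,
      map_smul, map_smul, hpow, smul_eq_mul, smul_eq_mul, smul_eq_mul]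
    ring

end Isometry

/-! ### Polynomials as vectors of the weighted `L²` spaces. -/

namespace IsWeight

variable {w : ℝ → ℝ}

/-- Polynomials as elements of `L²([0,1], w)`. -/
def polyLp (hw : IsWeight w) : Polynomial ℝ →ₗ[ℝ] WeightedL2 w :=
  haveI := hw.isFiniteMeasure
  polynomialToLp (densityMeasure_compl_Icc w)

theorem memLp_polynomial (hw : IsWeight w) (p : Polynomial ℝ) :
    MemLp (fun x => p.eval x) 2 (densityMeasure w) :=
  haveI := hw.isFiniteMeasure
  _root_.memLp_polynomial (densityMeasure_compl_Icc w) p 2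

theorem polyLp_apply (hw : IsWeight w) (p : Polynomial ℝ)
    (hp : MemLp (fun x => p.eval x) 2 (densityMeasure w)) :
    hw.polyLp p = hp.toLp (fun x => p.eval x) := rfl

theorem coeFn_polyLp (hw : IsWeight w) (p : Polynomial ℝ) :
    hw.polyLp p =ᵐ[densityMeasure w] fun x => p.eval x :=
  MemLp.coeFn_toLp (hw.memLp_polynomial p)

theorem inner_polyLp_left (hw : IsWeight w) (p : Polynomial ℝ) (f : WeightedL2 w) :
    inner ℝ (hw.polyLp p) f = ∫ x, p.eval x * f x ∂(densityMeasure w) :=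
  haveI := hw.isFiniteMeasure
  inner_polynomialToLp_left _ p f

theorem inner_polyLp (hw : IsWeight w) (p q : Polynomial ℝ) :
    inner ℝ (hw.polyLp p) (hw.polyLp q) = hw.moment (p * q) :=
  haveI := hw.isFiniteMeasure
  inner_polynomialToLp _ p q

theorem denseRange_polyLp (hw : IsWeight w) : DenseRange hw.polyLp :=
  haveI := hw.isFiniteMeasure
  denseRange_polynomialToLp _

theorem mem_orthHyperplane_iff (hw : IsWeight w) (f : WeightedL2 w) :
    f ∈ orthHyperplane w ↔ inner ℝ (hw.polyLp 1) f = 0 := by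
  have h1 : {e : WeightedL2 w | e =ᵐ[densityMeasure w] fun _ => (1 : ℝ)} = {hw.polyLp 1} := by
    ext e
    have h2 := hw.coeFn_polyLp 1
    simp only [Polynomial.eval_one] at h2
    refine ⟨fun h => Lp.ext (EventuallyEq.trans h h2.symm), fun h => ?_⟩
    rw [mem_singleton_iff.1 h]
    exact h2
  rw [orthHyperplane, h1, Submodule.mem_orthogonal_singleton_iff_inner_right]

end IsWeight

/-! ### The operator `T_ρ` and its adjoint. -/

section SecondaryOperator

variable {ρ μ : ℝ → ℝ}

theorem isSecondaryExtension_iff (hρ : IsWeight ρ) (hμ : IsWeight μ)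
    {T : WeightedL2 ρ →L[ℝ] WeightedL2 μ} : IsSecondaryExtension ρ μ T ↔
      ∀ p, T (hρ.polyLp p) = hμ.polyLp (hρ.secondaryPolynomial p) := by
  have h (p : Polynomial ℝ) : hμ.polyLp (hρ.secondaryPolynomial p) =ᵐ[densityMeasure μ]
      secondaryTransform ρ (fun x => p.eval x) := by
    filter_upwards [hμ.coeFn_polyLp (hρ.secondaryPolynomial p)] with x hx
    rw [hx, hρ.eval_secondaryPolynomial]
  refine ⟨fun hT p => Lp.ext ((hT p (hρ.memLp_polynomial p)).trans (h p).symm),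
    fun hT p hp => ?_⟩
  rw [← hρ.polyLp_apply, hT p]
  exact h p

theorem exists_isSecondaryExtension (hρ : IsContinuousProbDensity ρ)
    (hμ : IsSecondaryDensity ρ μ) :
    ∃ T : WeightedL2 ρ →L[ℝ] WeightedL2 μ, IsSecondaryExtension ρ μ T := by
  refine ⟨(hμ.isWeight.polyLp ∘ₗ hρ.isWeight.secondaryPolynomial).extendOfNorm hρ.isWeight.polyLp,
    (isSecondaryExtension_iff hρ.isWeight hμ.isWeight).2 fun p => ?_⟩
  -- The bound `1` holds because `‖Q p‖² = ‖p‖² - (L p)²`.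
  refine LinearMap.extendOfNorm_eq hρ.isWeight.denseRange_polyLp ⟨1, fun p => ?_⟩ p
  rw [one_mul, LinearMap.comp_apply, ← abs_of_nonneg (norm_nonneg (hμ.isWeight.polyLp _)),
    ← abs_of_nonneg (norm_nonneg (hρ.isWeight.polyLp p)), ← sq_le_sq,
    ← real_inner_self_eq_norm_sq, ← real_inner_self_eq_norm_sq, IsWeight.inner_polyLp,
    IsWeight.inner_polyLp, moment_secondaryPolynomial_mul hρ hμ]
  nlinarith [mul_self_nonneg (hρ.isWeight.moment p)]

theorem isSecondaryExtension_secondaryOperator (hρ : IsContinuousProbDensity ρ)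
    (hμ : IsSecondaryDensity ρ μ) : IsSecondaryExtension ρ μ (secondaryOperator ρ μ) := by
  have h := exists_isSecondaryExtension hρ hμ
  rw [secondaryOperator, dif_pos h]
  exact h.choose_spec

theorem secondaryOperator_polyLp (hρ : IsContinuousProbDensity ρ) (hμ : IsSecondaryDensity ρ μ)
    (p : Polynomial ℝ) : secondaryOperator ρ μ (hρ.isWeight.polyLp p) =
      hμ.isWeight.polyLp (hρ.isWeight.secondaryPolynomial p) :=
  (isSecondaryExtension_iff hρ.isWeight hμ.isWeight).1
    (isSecondaryExtension_secondaryOperator hρ hμ) p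

theorem inner_secondaryOperator (hρ : IsContinuousProbDensity ρ) (hμ : IsSecondaryDensity ρ μ)
    (f g : WeightedL2 ρ) :
    inner ℝ (secondaryOperator ρ μ f) (secondaryOperator ρ μ g) =
      inner ℝ f g - inner ℝ (hρ.isWeight.polyLp 1) f * inner ℝ (hρ.isWeight.polyLp 1) g := by
  refine hρ.isWeight.denseRange_polyLp.induction_on₂
    (isClosed_eq (by fun_prop) (by fun_prop)) (fun p q => ?_) f g
  rw [secondaryOperator_polyLp hρ hμ, secondaryOperator_polyLp hρ hμ]
  simp only [IsWeight.inner_polyLp, moment_secondaryPolynomial_mul hρ hμ, one_mul]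

theorem secondaryOperator_polyLp_one (hρ : IsContinuousProbDensity ρ)
    (hμ : IsSecondaryDensity ρ μ) : secondaryOperator ρ μ (hρ.isWeight.polyLp 1) = 0 := by
  rw [secondaryOperator_polyLp hρ hμ, IsWeight.secondaryPolynomial_one, map_zero]

theorem denseRange_secondaryOperator (hρ : IsContinuousProbDensity ρ)
    (hμ : IsSecondaryDensity ρ μ) : DenseRange (secondaryOperator ρ μ) := by
  refine hμ.isWeight.denseRange_polyLp.mono ?_
  rintro _ ⟨q, rfl⟩
  obtain ⟨p, rfl⟩ := hρ.isWeight.secondaryPolynomial_surjective hρ.moment_one q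
  exact ⟨_, secondaryOperator_polyLp hρ hμ p⟩

/-- On a vector `T g`, `T*` returns `g` minus its component along `1`, and `T` kills `1`. Density of
the range and continuity do the rest. -/
theorem secondaryOperator_adjoint (hρ : IsContinuousProbDensity ρ) (hμ : IsSecondaryDensity ρ μ)
    (h : WeightedL2 μ) :
    secondaryOperator ρ μ (ContinuousLinearMap.adjoint (secondaryOperator ρ μ) h) = h := by
  refine (denseRange_secondaryOperator hρ hμ).induction_on
    (p := fun h => secondaryOperator ρ μ (ContinuousLinearMap.adjoint (secondaryOperator ρ μ) h) = h)
    h (isClosed_eq (by fun_prop) (by fun_prop)) fun g => ?_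
  have h1 : ContinuousLinearMap.adjoint (secondaryOperator ρ μ) (secondaryOperator ρ μ g) =
      g - (inner ℝ (hρ.isWeight.polyLp 1) g) • hρ.isWeight.polyLp 1 := by
    refine ext_inner_left ℝ fun f => ?_
    rw [ContinuousLinearMap.adjoint_inner_right, inner_secondaryOperator hρ hμ, inner_sub_right,
      inner_smul_right, real_inner_comm f, mul_comm]
  rw [h1, map_sub, map_smul, secondaryOperator_polyLp_one hρ hμ, smul_zero, sub_zero]

theorem norm_adjoint_secondaryOperator (hρ : IsContinuousProbDensity ρ)
    (hμ : IsSecondaryDensity ρ μ) (h : WeightedL2 μ) :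
    ‖ContinuousLinearMap.adjoint (secondaryOperator ρ μ) h‖ = ‖h‖ := by
  rw [← sq_eq_sq₀ (norm_nonneg _) (norm_nonneg _), ← real_inner_self_eq_norm_sq,
    ← real_inner_self_eq_norm_sq, ContinuousLinearMap.adjoint_inner_right,
    secondaryOperator_adjoint hρ hμ]

theorem adjoint_secondaryOperator_mem (hρ : IsContinuousProbDensity ρ)
    (hμ : IsSecondaryDensity ρ μ) (h : WeightedL2 μ) :
    ContinuousLinearMap.adjoint (secondaryOperator ρ μ) h ∈ orthHyperplane ρ := by
  rw [hρ.isWeight.mem_orthHyperplane_iff, ContinuousLinearMap.adjoint_inner_right,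
    secondaryOperator_polyLp_one hρ hμ, inner_zero_left]

end SecondaryOperator

/-! ### Poisson integrals on the half plane. -/

/-- `π` times the Poisson kernel of the upper half plane. -/
def halfPlaneKernel (ε s : ℝ) : ℝ := ε / (s ^ 2 + ε ^ 2)

/-- The convolution of `w` on `[0,1]` with `halfPlaneKernel ε`. -/
def halfPlaneIntegral (w : ℝ → ℝ) (ε x : ℝ) : ℝ :=
  ∫ t in Icc (0 : ℝ) 1, halfPlaneKernel ε (x - t) * w t

section Kernel

variable {ε : ℝ}

theorem halfPlaneKernel_nonneg (hε : 0 < ε) (s : ℝ) : 0 ≤ halfPlaneKernel ε s := by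
  unfold halfPlaneKernel; positivity

theorem continuous_halfPlaneKernel (hε : 0 < ε) : Continuous (halfPlaneKernel ε) := by
  unfold halfPlaneKernel
  exact continuous_const.div (by fun_prop) fun s => by positivity

theorem halfPlaneKernel_le_inv (hε : 0 < ε) (s : ℝ) : halfPlaneKernel ε s ≤ ε⁻¹ := by
  unfold halfPlaneKernel
  rw [div_le_iff₀ (by positivity)]
  have : ε⁻¹ * (s ^ 2 + ε ^ 2) = ε⁻¹ * s ^ 2 + ε := by field_simp
  rw [this]
  have : 0 ≤ ε⁻¹ * s ^ 2 := by positivity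
  linarith

theorem halfPlaneKernel_le_of_le (hε : 0 < ε) {δ s : ℝ} (hδ : 0 < δ) (hs : δ ≤ |s|) :
    halfPlaneKernel ε s ≤ ε / δ ^ 2 := by
  unfold halfPlaneKernel
  have : δ ^ 2 ≤ s ^ 2 := by rw [← sq_abs s]; gcongr
  gcongr
  nlinarith [sq_nonneg ε]

theorem halfPlaneKernel_eq (hε : 0 < ε) (s : ℝ) :
    halfPlaneKernel ε s = ε⁻¹ * (1 + (s / ε) ^ 2)⁻¹ := by
  unfold halfPlaneKernel
  have : s ^ 2 + ε ^ 2 ≠ 0 := by positivity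
  field_simp
  ring

theorem integrable_halfPlaneKernel (hε : 0 < ε) : Integrable (halfPlaneKernel ε) := by
  rw [show halfPlaneKernel ε = _ from funext (halfPlaneKernel_eq hε)]
  exact (integrable_inv_one_add_sq.comp_div hε.ne').const_mul _

theorem integral_halfPlaneKernel (hε : 0 < ε) : ∫ s, halfPlaneKernel ε s = Real.pi := by
  simp only [halfPlaneKernel_eq hε]
  rw [integral_const_mul, Measure.integral_comp_div (fun x : ℝ => (1 + x ^ 2)⁻¹) ε,
    integral_univ_inv_one_add_sq, abs_of_pos hε, smul_eq_mul]
  field_simp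

theorem lintegral_halfPlaneKernel_sub_le (hε : 0 < ε) (s : Set ℝ) (t : ℝ) :
    ∫⁻ x in s, ENNReal.ofReal (halfPlaneKernel ε (x - t)) ≤ ENNReal.ofReal Real.pi := by
  refine (setLIntegral_le_lintegral s _).trans (le_of_eq ?_)
  rw [lintegral_sub_right_eq_self (fun x => ENNReal.ofReal (halfPlaneKernel ε x)) t,
    ← ofReal_integral_eq_lintegral_ofReal (integrable_halfPlaneKernel hε)
      (Eventually.of_forall (halfPlaneKernel_nonneg hε)), integral_halfPlaneKernel hε]

end Kernel

/-! ### Boundary values of Stieltjes transforms. -/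

section BoundaryValues

variable {w : ℝ → ℝ} {ε : ℝ}

theorem IsWeight.integrableOn_halfPlaneKernel_mul (hw : IsWeight w) (hε : 0 < ε) (x : ℝ) :
    IntegrableOn (fun t => halfPlaneKernel ε (x - t) * w t) (Icc 0 1) := by
  refine hw.integrableOn.bdd_mul (c := ε⁻¹) ?_ (Eventually.of_forall fun t => ?_)
  · exact ((continuous_halfPlaneKernel hε).comp (by fun_prop)).aestronglyMeasurable
  · rw [Real.norm_of_nonneg (halfPlaneKernel_nonneg hε _)]
    exact halfPlaneKernel_le_inv hε _

theorem IsWeight.integrableOn_mul_div (hw : IsWeight w) (hε : 0 < ε) (x : ℝ) :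
    IntegrableOn (fun t => (x - t) * w t / ((x - t) ^ 2 + ε ^ 2)) (Icc 0 1) := by
  have h : Continuous fun t : ℝ => (x - t) / ((x - t) ^ 2 + ε ^ 2) :=
    Continuous.div (by fun_prop) (by fun_prop) fun t => by positivity
  refine (hw.integrableOn.bdd_mul (c := ε⁻¹) h.aestronglyMeasurable
    (Eventually.of_forall fun t => ?_)).congr (Eventually.of_forall fun t => ?_)
  · rw [Real.norm_eq_abs, abs_div, abs_of_pos (by positivity : 0 < (x - t) ^ 2 + ε ^ 2),
      div_le_iff₀ (by positivity), ← sq_abs (x - t)]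
    field_simp
    nlinarith [sq_nonneg (|x - t| - ε), abs_nonneg (x - t)]
  · simp only
    ring

/-- Approaching the cut from below gives `1 / (s - iε) = (s + iε) / (s² + ε²)`, so the Poisson part
appears with a positive sign. -/
theorem IsWeight.stieltjesTransform_sub_mul_I (hw : IsWeight w) (hε : 0 < ε) (x : ℝ) :
    stieltjesTransform w (x - ε * Complex.I) =
      ((reducerApprox w ε x / 2 : ℝ) : ℂ) + (halfPlaneIntegral w ε x : ℝ) * Complex.I := by
  rw [reducerApprox, mul_div_cancel_left₀ _ two_ne_zero, halfPlaneIntegral,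
    ← integral_complex_ofReal, ← integral_complex_ofReal, ← integral_mul_const, ← integral_add
      (hw.integrableOn_mul_div hε x).ofReal
      ((hw.integrableOn_halfPlaneKernel_mul hε x).ofReal.mul_const _), stieltjesTransform]
  refine integral_congr_ae (Eventually.of_forall fun t => ?_)
  have h0 : (x : ℂ) - ε * Complex.I - t ≠ 0 := fun h => by
    have := congrArg Complex.im h
    simp at this
    exact hε.ne' this
  have h1 : ((x : ℂ) - t) ^ 2 + ε ^ 2 ≠ 0 := by
    have : (x - t) ^ 2 + ε ^ 2 ≠ 0 := by positivity
    exact_mod_cast this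
  simp only [halfPlaneKernel]
  push_cast
  rw [div_eq_iff h0]
  field_simp
  linear_combination ((w t : ℂ) * ε ^ 2) * Complex.I_sq

/-- Imaginary part of the secondary relation: `-1/S` contributes `Im S / |S|²`, and `z` contributes
`-ε`. -/
theorem halfPlaneIntegral_secondary {ρ μ : ℝ → ℝ} (hρ : IsContinuousProbDensity ρ)
    (hμ : IsSecondaryDensity ρ μ) (hε : 0 < ε) (x : ℝ) :
    halfPlaneIntegral μ ε x = halfPlaneIntegral ρ ε x /
      ((reducerApprox ρ ε x / 2) ^ 2 + halfPlaneIntegral ρ ε x ^ 2) - ε := by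
  have h := hμ.stieltjes_eq (x - ε * Complex.I) (by
    rintro ⟨t, -, ht⟩
    have := congrArg Complex.im ht
    simp at this
    exact hε.ne' this)
  rw [hμ.isWeight.stieltjesTransform_sub_mul_I hε,
    hρ.isWeight.stieltjesTransform_sub_mul_I hε] at h
  have h2 := congrArg Complex.im h
  simp only [one_div, Complex.add_im, Complex.sub_im, Complex.inv_im, Complex.mul_im,
    Complex.ofReal_im, Complex.ofReal_re, Complex.I_im, Complex.I_re, Complex.normSq_add_mul_I]
    at h2
  simp only [mul_one, mul_zero, add_zero, zero_add, zero_sub, sub_zero] at h2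
  linear_combination h2

end BoundaryValues

/-! ### Absolute continuity of `ρ dx` with respect to `μ dx`. -/

section AbsoluteContinuity

variable {w ρ μ : ℝ → ℝ}

theorem IsWeight.exists_bounds_halfPlaneIntegral (hw : IsWeight w)
    (hc : ContinuousOn w (Ioo 0 1)) {x : ℝ} (hx : x ∈ Ioo (0 : ℝ) 1) (hpos : 0 < w x) :
    ∃ a b : ℝ, 0 < a ∧ ∀ᶠ ε in 𝓝[>] (0 : ℝ),
      a ≤ halfPlaneIntegral w ε x ∧ halfPlaneIntegral w ε x ≤ b := by
  have hcx : ContinuousAt w x := hc.continuousAt (Ioo_mem_nhds hx.1 hx.2)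
  have hev : ∀ᶠ t in 𝓝 x, t ∈ Ioo (0 : ℝ) 1 ∧ w t ∈ Ioo (w x / 2) (2 * w x) :=
    (show ∀ᶠ t in 𝓝 x, t ∈ Ioo (0 : ℝ) 1 from Ioo_mem_nhds hx.1 hx.2).and
      (hcx (Ioo_mem_nhds (by linarith) (by linarith)))
  obtain ⟨δ, hδ, hball⟩ := Metric.eventually_nhds_iff.1 hev
  -- Lower bound: on `|x - t| ≤ ε`, of length `2ε`, the kernel is at least `1/(2ε)` and `w ≥ w x /
  -- 2`. Upper bound: within `δ` of `x`, `w ≤ 2 w x` and the kernel has mass at most `π`; beyond,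
  -- the kernel is at most `ε/δ² ≤ 1/δ`.
  refine ⟨w x / 2, 2 * w x * Real.pi + δ⁻¹ * ∫ t in Icc (0 : ℝ) 1, w t, by linarith, ?_⟩
  filter_upwards [Ioo_mem_nhdsGT hδ] with ε hε
  have hε0 : 0 < ε := hε.1
  constructor
  · have hsub : Icc (x - ε) (x + ε) ⊆ Icc 0 1 := fun t ht =>
      Ioo_subset_Icc_self (hball (y := t) (by
        rw [Real.dist_eq, abs_lt]; constructor <;> linarith [ht.1, ht.2, hε.2])).1
    calc w x / 2 = ∫ t in Icc (x - ε) (x + ε), w x / (4 * ε) := by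
          rw [setIntegral_const, measureReal_def, Real.volume_Icc,
            ENNReal.toReal_ofReal (by linarith), smul_eq_mul]
          field_simp
          ring
      _ ≤ ∫ t in Icc (x - ε) (x + ε), halfPlaneKernel ε (x - t) * w t := by
          refine setIntegral_mono_on (integrableOn_const (by simp))
            ((hw.integrableOn_halfPlaneKernel_mul hε0 x).mono_set hsub) measurableSet_Icc
            fun t ht => ?_
          have hwt := (hball (y := t) (by
            rw [Real.dist_eq, abs_lt]; constructor <;> linarith [ht.1, ht.2, hε.2])).2
          have hk : (2 * ε)⁻¹ ≤ halfPlaneKernel ε (x - t) := by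
            unfold halfPlaneKernel
            rw [inv_eq_one_div, div_le_div_iff₀ (by positivity) (by positivity)]
            nlinarith [ht.1, ht.2]
          calc w x / (4 * ε) = (2 * ε)⁻¹ * (w x / 2) := by field_simp; ring
            _ ≤ _ := mul_le_mul hk hwt.1.le (by linarith) (halfPlaneKernel_nonneg hε0 _)
      _ ≤ halfPlaneIntegral w ε x := by
          refine setIntegral_mono_set (hw.integrableOn_halfPlaneKernel_mul hε0 x) ?_
            hsub.eventuallyLE
          filter_upwards [hw.ae_nonneg] with t ht
          exact mul_nonneg (halfPlaneKernel_nonneg hε0 _) ht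
  · have hk := (integrable_halfPlaneKernel hε0).comp_sub_left x
    have hkpi : ∫ t in Icc (0 : ℝ) 1, halfPlaneKernel ε (x - t) ≤ Real.pi := by
      rw [← integral_halfPlaneKernel hε0, ← integral_sub_left_eq_self (halfPlaneKernel ε) volume x]
      exact setIntegral_le_integral hk
        (Eventually.of_forall fun t => halfPlaneKernel_nonneg hε0 _)
    calc halfPlaneIntegral w ε x
        ≤ ∫ t in Icc (0 : ℝ) 1, (2 * w x * halfPlaneKernel ε (x - t) + δ⁻¹ * w t) := by
          refine integral_mono_ae (hw.integrableOn_halfPlaneKernel_mul hε0 x)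
            ((hk.integrableOn.const_mul _).add (hw.integrableOn.const_mul _)) ?_
          filter_upwards [hw.ae_nonneg] with t ht
          have hk0 := halfPlaneKernel_nonneg hε0 (x - t)
          rcases lt_or_ge |x - t| δ with h | h
          · have hwt := (hball (y := t) (by rwa [Real.dist_eq, abs_sub_comm])).2.2
            have := mul_le_mul_of_nonneg_left hwt.le hk0
            have : 0 ≤ δ⁻¹ * w t := by positivity
            linarith
          · have h1 : halfPlaneKernel ε (x - t) ≤ δ⁻¹ := by
              refine (halfPlaneKernel_le_of_le hε0 hδ h).trans ?_
              rw [div_le_iff₀ (by positivity), pow_two, inv_mul_cancel_left₀ hδ.ne']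
              exact hε.2.le
            have := mul_le_mul_of_nonneg_right h1 ht
            have : 0 ≤ 2 * w x * halfPlaneKernel ε (x - t) := by positivity
            linarith
      _ = 2 * w x * (∫ t in Icc (0 : ℝ) 1, halfPlaneKernel ε (x - t)) +
            δ⁻¹ * ∫ t in Icc (0 : ℝ) 1, w t := by
          rw [integral_add (hk.integrableOn.const_mul _) (hw.integrableOn.const_mul _),
            integral_const_mul, integral_const_mul]
      _ ≤ _ := by gcongr

theorem eventually_le_halfPlaneIntegral_secondary (hρ : IsContinuousProbDensity ρ)
    (hμ : IsSecondaryDensity ρ μ) {x l : ℝ} (hx : x ∈ Ioo (0 : ℝ) 1) (hpos : 0 < ρ x)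
    (hl : Tendsto (fun ε => reducerApprox ρ ε x) (𝓝[>] 0) (𝓝 l)) :
    ∃ c : ℝ, 0 < c ∧ ∀ᶠ ε in 𝓝[>] (0 : ℝ), c ≤ halfPlaneIntegral μ ε x := by
  obtain ⟨a, b, ha, hab⟩ := hρ.isWeight.exists_bounds_halfPlaneIntegral hρ.continuousOn hx hpos
  have hR : ∀ᶠ ε in 𝓝[>] (0 : ℝ), (reducerApprox ρ ε x / 2) ^ 2 < (l / 2) ^ 2 + 1 :=
    ((hl.div_const 2).pow 2).eventually (gt_mem_nhds (by linarith))
  set D := (l / 2) ^ 2 + 1 + b ^ 2 with hD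
  have hDpos : 0 < D := by positivity
  -- `a / D` bounds the quotient in `halfPlaneIntegral_secondary` from below; half of it absorbs the
  -- term `-ε`.
  refine ⟨a / D / 2, by positivity, ?_⟩
  filter_upwards [hab, hR, Ioo_mem_nhdsGT (show 0 < a / D / 2 by positivity)] with ε h1 h2 h3
  rw [halfPlaneIntegral_secondary hρ hμ h3.1]
  have h4 : 0 < halfPlaneIntegral ρ ε x := ha.trans_le h1.1
  have h5 : a / D ≤ halfPlaneIntegral ρ ε x /
      ((reducerApprox ρ ε x / 2) ^ 2 + halfPlaneIntegral ρ ε x ^ 2) := by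
    refine div_le_div₀ h4.le h1.1 (by positivity) ?_
    have : halfPlaneIntegral ρ ε x ^ 2 ≤ b ^ 2 := by gcongr; exact h1.2
    linarith
  linarith [h3.2]

theorem IsWeight.ofReal_halfPlaneIntegral (hw : IsWeight w) {ε : ℝ} (hε : 0 < ε) (x : ℝ) :
    ENNReal.ofReal (halfPlaneIntegral w ε x) =
      ∫⁻ t, ENNReal.ofReal (halfPlaneKernel ε (x - t)) ∂(densityMeasure w) := by
  rw [hw.lintegral_eq, halfPlaneIntegral, ofReal_integral_eq_lintegral_ofReal
    (hw.integrableOn_halfPlaneKernel_mul hε x)]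
  · refine lintegral_congr fun t => ?_
    rw [ENNReal.ofReal_mul (halfPlaneKernel_nonneg hε _), mul_comm]
  · filter_upwards [hw.ae_nonneg] with t ht using mul_nonneg (halfPlaneKernel_nonneg hε _) ht
  · exact ((continuous_halfPlaneKernel hε).comp (by fun_prop)).measurable.ennreal_ofReal.aemeasurable

theorem measurable_halfPlaneKernel_uncurry {ε : ℝ} (hε : 0 < ε) :
    Measurable fun p : ℝ × ℝ => ENNReal.ofReal (halfPlaneKernel ε (p.1 - p.2)) :=
  ((continuous_halfPlaneKernel hε).comp (by fun_prop)).measurable.ennreal_ofReal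

theorem tendsto_lintegral_halfPlaneKernel {F : Set ℝ} (hF : IsCompact F) {t : ℝ} (ht : t ∉ F)
    {ε : ℕ → ℝ} (hε : ∀ n, 0 < ε n) (hlim : Tendsto ε atTop (𝓝 0)) :
    Tendsto (fun n => ∫⁻ x in F, ENNReal.ofReal (halfPlaneKernel (ε n) (x - t))) atTop (𝓝 0) := by
  obtain ⟨δ, hδ, hball⟩ := Metric.isOpen_iff.1 hF.isClosed.isOpen_compl t ht
  have hup : Tendsto (fun n => ENNReal.ofReal (ε n / δ ^ 2) * volume F) atTop (𝓝 0) := by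
    have h1 : Tendsto (fun n => ENNReal.ofReal (ε n / δ ^ 2)) atTop (𝓝 0) := by
      simpa using ENNReal.tendsto_ofReal (hlim.div_const (δ ^ 2))
    simpa using ENNReal.Tendsto.mul_const h1 (Or.inr hF.measure_lt_top.ne)
  refine tendsto_of_tendsto_of_tendsto_of_le_of_le tendsto_const_nhds hup (fun _ => zero_le)
    fun n => ?_
  rw [← setLIntegral_const]
  refine setLIntegral_mono' hF.measurableSet fun x hx => ENNReal.ofReal_le_ofReal ?_
  refine halfPlaneKernel_le_of_le (hε n) hδ ?_
  by_contra! h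
  exact hball (show x ∈ Metric.ball t δ by rwa [Metric.mem_ball, Real.dist_eq]) hx

/-- After Tonelli the inner integral over `F` is at most `π` and tends to zero for `t ∉ F`, that is,
for almost every `t`; dominated convergence concludes. -/
theorem IsWeight.tendsto_lintegral_halfPlaneIntegral (hw : IsWeight w) {F : Set ℝ}
    (hF : IsCompact F) (h0 : densityMeasure w F = 0) {ε : ℕ → ℝ} (hε : ∀ n, 0 < ε n)
    (hlim : Tendsto ε atTop (𝓝 0)) :
    Tendsto (fun n => ∫⁻ x in F, ENNReal.ofReal (halfPlaneIntegral w (ε n) x)) atTop (𝓝 0) := by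
  have := hw.isFiniteMeasure
  have hswap (n : ℕ) : ∫⁻ x in F, ENNReal.ofReal (halfPlaneIntegral w (ε n) x) =
      ∫⁻ t, (∫⁻ x in F, ENNReal.ofReal (halfPlaneKernel (ε n) (x - t))) ∂(densityMeasure w) := by
    simp only [hw.ofReal_halfPlaneIntegral (hε n)]
    exact lintegral_lintegral_swap (μ := volume.restrict F) (ν := densityMeasure w)
      (f := fun x t => ENNReal.ofReal (halfPlaneKernel (ε n) (x - t)))
      (measurable_halfPlaneKernel_uncurry (hε n)).aemeasurable
  simp only [hswap]
  rw [← lintegral_zero (μ := densityMeasure w)]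
  refine tendsto_lintegral_of_dominated_convergence (μ := densityMeasure w) (fun _ => ENNReal.ofReal Real.pi)
    (fun n => ?_) (fun n => ?_)
    (by rw [lintegral_const]; exact ENNReal.mul_ne_top ENNReal.ofReal_ne_top (measure_ne_top _ _)) ?_
  · exact (measurable_halfPlaneKernel_uncurry (hε n)).lintegral_prod_left'
  · exact Eventually.of_forall fun t => lintegral_halfPlaneKernel_sub_le (hε n) F t
  · filter_upwards [measure_eq_zero_iff_ae_notMem.1 h0] with t ht
    exact tendsto_lintegral_halfPlaneKernel hF ht hε hlim

/-- The secondary density vanishes almost nowhere on the set where the density is positive. -/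
theorem ae_secondaryDensity_ne_zero (hρ : IsContinuousProbDensity ρ)
    (hμ : IsSecondaryDensity ρ μ) (hlim : ∀ᵐ x ∂(volume.restrict (Icc (0 : ℝ) 1)),
      ∃ l : ℝ, Tendsto (fun ε => reducerApprox ρ ε x) (𝓝[>] 0) (𝓝 l)) :
    ∀ᵐ x ∂(volume.restrict (Icc (0 : ℝ) 1)), ρ x ≠ 0 → μ x ≠ 0 := by
  have hμm : AEMeasurable μ (volume.restrict (Icc (0 : ℝ) 1)) := hμ.integrableOn.aemeasurable
  set μ' := hμm.mk μ with hμ'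
  set E : Set ℝ := (Ioo 0 1 ∩ ρ ⁻¹' Ioi 0) ∩ μ' ⁻¹' {0} with hE
  have hEm : MeasurableSet E :=
    (hρ.continuousOn.isOpen_inter_preimage isOpen_Ioo isOpen_Ioi).measurableSet.inter
      (hμm.measurable_mk (measurableSet_singleton 0))
  suffices hE0 : volume E = 0 by
    filter_upwards [hμm.ae_eq_mk, ae_Icc_mem_Ioo,
      ae_restrict_of_ae (measure_eq_zero_iff_ae_notMem.1 hE0)] with x h1 h2 h3 h4 h5
    exact h3 ⟨⟨h2, lt_of_le_of_ne (hρ.nonneg x h2) (Ne.symm h4)⟩, h1.symm.trans h5⟩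
  by_contra hne
  -- Compactness puts every point outside `F` at positive distance from it, which the decay of the
  -- kernel requires.
  obtain ⟨F, hFE, hF, hFpos⟩ := hEm.exists_lt_isCompact (pos_iff_ne_zero.2 hne)
  have hFI : F ⊆ Icc 0 1 := fun x hx => Ioo_subset_Icc_self (hFE hx).1.1
  have hres : volume.restrict F ≤ volume.restrict (Icc (0 : ℝ) 1) :=
    Measure.restrict_mono_set _ hFI
  have hμF : densityMeasure μ F = 0 := by
    rw [measure_eq_zero_iff_ae_notMem, hμ.isWeight.ae_iff]
    filter_upwards [hμm.ae_eq_mk] with x h1 h2 h3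
    exact h2 (h1.trans (hFE h3).2)
  let ε : ℕ → ℝ := fun n => 1 / ((n : ℝ) + 1)
  have hε : ∀ n, 0 < ε n := fun n => Nat.one_div_pos_of_nat
  have hε0 : Tendsto ε atTop (𝓝 0) := tendsto_one_div_add_atTop_nhds_zero_nat
  have hε0' : Tendsto ε atTop (𝓝[>] 0) :=
    tendsto_nhdsWithin_iff.2 ⟨hε0, Eventually.of_forall hε⟩
  have hmeas (n : ℕ) :
      Measurable fun x => ENNReal.ofReal (halfPlaneIntegral μ (ε n) x) := by
    have := hμ.isWeight.isFiniteMeasure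
    simp only [hμ.isWeight.ofReal_halfPlaneIntegral (hε n)]
    exact (measurable_halfPlaneKernel_uncurry (hε n)).lintegral_prod_right'
  -- Fatou makes the lower limit zero almost everywhere on `F`, against the pointwise lower bound
  -- there.
  have hfatou : ∫⁻ x in F, liminf (fun n => ENNReal.ofReal (halfPlaneIntegral μ (ε n) x)) atTop
      = 0 := by
    refine le_antisymm ((lintegral_liminf_le hmeas).trans (le_of_eq ?_)) zero_le
    exact (hμ.isWeight.tendsto_lintegral_halfPlaneIntegral hF hμF hε hε0).liminf_eq
  rw [lintegral_eq_zero_iff (Measurable.liminf hmeas)] at hfatou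
  have hfalse : ∀ᵐ x ∂(volume.restrict F), False := by
    filter_upwards [hfatou, ae_mono hres hlim, ae_restrict_mem hF.measurableSet] with x h1 h2 h3
    obtain ⟨l, hl⟩ := h2
    obtain ⟨c, hc, hev⟩ := eventually_le_halfPlaneIntegral_secondary hρ hμ (hFE h3).1.1
      (hFE h3).1.2 hl
    have h4 : ENNReal.ofReal c ≤
        liminf (fun n => ENNReal.ofReal (halfPlaneIntegral μ (ε n) x)) atTop :=
      le_liminf_of_le (by isBoundedDefault)
        ((hε0'.eventually hev).mono fun n hn => ENNReal.ofReal_le_ofReal hn)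
    rw [h1] at h4
    exact absurd h4 (by simpa using hc)
  rw [ae_iff] at hfalse
  simp only [not_false_eq_true, ofPred_true, Measure.restrict_apply_univ] at hfalse
  exact hFpos.ne' hfalse

theorem densityMeasure_absolutelyContinuous_secondary (hρ : IsContinuousProbDensity ρ)
    (hμ : IsSecondaryDensity ρ μ) (hlim : ∀ᵐ x ∂(volume.restrict (Icc (0 : ℝ) 1)),
      ∃ l : ℝ, Tendsto (fun ε => reducerApprox ρ ε x) (𝓝[>] 0) (𝓝 l)) :
    densityMeasure ρ ≪ densityMeasure μ := by
  rw [← Measure.ae_le_iff_absolutelyContinuous]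
  intro s hs
  refine hρ.isWeight.ae_iff.2 ?_
  filter_upwards [hμ.isWeight.ae_iff.1 hs, ae_secondaryDensity_ne_zero hρ hμ hlim] with x h1 h2 h3
    using h1 (h2 h3)

end AbsoluteContinuity

/-! ### Multiplication by `ρ / μ` between the weighted spaces. -/

section Transfer

variable {ρ μ : ℝ → ℝ}

/-- `ρ²/μ = μ (ρ/μ)²` holds even where `μ = 0`, both sides being `0` by the convention for division.
-/
theorem IsWeight.sq_div (hμ : IsWeight μ)
    (hq : MemLp (fun x => ρ x / μ x) 2 (densityMeasure μ)) : IsWeight (fun x => ρ x ^ 2 / μ x) where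
  nonneg x hx := div_nonneg (sq_nonneg _) (hμ.nonneg x hx)
  integrableOn := by
    refine ((hμ.integrable_iff _).1 hq.integrable_sq).congr (Eventually.of_forall fun x => ?_)
    rcases eq_or_ne (μ x) 0 with h | h
    · simp [h]
    · simp only [smul_eq_mul]
      field_simp

theorem smul_sq_div_mul (ρ μ f : ℝ → ℝ) (x : ℝ) :
    μ x • (ρ x / μ x * f x) ^ 2 = (ρ x ^ 2 / μ x) • f x ^ 2 := by
  rcases eq_or_ne (μ x) 0 with h | h
  · simp [h]
  · simp only [smul_eq_mul]
    field_simp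

theorem memLp_div_mul (hμ : IsWeight μ) (hv : IsWeight (fun x => ρ x ^ 2 / μ x))
    (hq : MemLp (fun x => ρ x / μ x) 2 (densityMeasure μ))
    (f : WeightedL2 (fun x => ρ x ^ 2 / μ x)) :
    MemLp (fun x => ρ x / μ x * f x) 2 (densityMeasure μ) := by
  refine (memLp_two_iff_integrable_sq
    (hq.1.mul (Lp.stronglyMeasurable f).aestronglyMeasurable)).2 ((hμ.integrable_iff _).2 ?_)
  simp only [Pi.mul_apply, smul_sq_div_mul]
  exact (hv.integrable_iff _).1 (Lp.memLp f).integrable_sq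

/-- A null set for `ρ²/μ` may have positive `μ`-mass, but only where `ρ/μ` vanishes; the factor
`ρ/μ` then makes the values of `f` there irrelevant. -/
theorem ae_imp_of_ae_sq_div (hμ : IsWeight μ) (hv : IsWeight (fun x => ρ x ^ 2 / μ x))
    {p : ℝ → Prop} (h : ∀ᵐ x ∂(densityMeasure (fun x => ρ x ^ 2 / μ x)), p x) :
    ∀ᵐ x ∂(densityMeasure μ), ρ x / μ x ≠ 0 → p x := by
  rw [hμ.ae_iff]
  filter_upwards [hv.ae_iff.1 h] with x h1 h2 h3
  exact h1 (div_ne_zero (pow_ne_zero 2 (div_ne_zero_iff.1 h3).1) h2)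

/-- Multiplication by `ρ / μ`, as an isometry from `L²([0,1], ρ² / μ)` to `L²([0,1], μ)`. -/
def divMulIsometry (hμ : IsWeight μ) (hv : IsWeight (fun x => ρ x ^ 2 / μ x))
    (hq : MemLp (fun x => ρ x / μ x) 2 (densityMeasure μ)) :
    WeightedL2 (fun x => ρ x ^ 2 / μ x) →ₗᵢ[ℝ] WeightedL2 μ where
  toFun f := (memLp_div_mul hμ hv hq f).toLp _
  map_add' f g := by
    rw [← MemLp.toLp_add]
    refine MemLp.toLp_congr _ _ ?_
    filter_upwards [ae_imp_of_ae_sq_div hμ hv (Lp.coeFn_add f g)] with x hx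
    rcases eq_or_ne (ρ x / μ x) 0 with h | h
    · simp [h]
    · simp only [Pi.add_apply, hx h]
      ring
  map_smul' c f := by
    rw [RingHom.id_apply, ← MemLp.toLp_const_smul]
    refine MemLp.toLp_congr _ _ ?_
    filter_upwards [ae_imp_of_ae_sq_div hμ hv (Lp.coeFn_smul c f)] with x hx
    rcases eq_or_ne (ρ x / μ x) 0 with h | h
    · simp [h]
    · simp only [Pi.smul_apply, hx h, smul_eq_mul]
      ring
  norm_map' f := by
    rw [← sq_eq_sq₀ (norm_nonneg _) (norm_nonneg _), ← real_inner_self_eq_norm_sq,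
      ← real_inner_self_eq_norm_sq, L2.inner_def, L2.inner_def]
    have h1 : ∀ᵐ x ∂(densityMeasure μ), inner ℝ ((memLp_div_mul hμ hv hq f).toLp _ x)
        ((memLp_div_mul hμ hv hq f).toLp _ x) = (ρ x / μ x * f x) ^ 2 := by
      filter_upwards [MemLp.coeFn_toLp (memLp_div_mul hμ hv hq f)] with x hx
      rw [hx, real_inner_self_eq_norm_sq, Real.norm_eq_abs, sq_abs]
    refine (integral_congr_ae h1).trans ?_
    rw [hμ.integral_eq, hv.integral_eq]
    simp only [smul_sq_div_mul, real_inner_self_eq_norm_sq, Real.norm_eq_abs, sq_abs]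

theorem coeFn_divMulIsometry (hμ : IsWeight μ) (hv : IsWeight (fun x => ρ x ^ 2 / μ x))
    (hq : MemLp (fun x => ρ x / μ x) 2 (densityMeasure μ))
    (f : WeightedL2 (fun x => ρ x ^ 2 / μ x)) :
    divMulIsometry hμ hv hq f =ᵐ[densityMeasure μ] fun x => ρ x / μ x * f x :=
  MemLp.coeFn_toLp (memLp_div_mul hμ hv hq f)

/-- The cancellation could fail only where `μ = 0 ≠ ρ`, a null set by `hac`. -/
theorem ae_smul_div_mul (hac : ∀ᵐ x ∂(volume.restrict (Icc (0 : ℝ) 1)), ρ x ≠ 0 → μ x ≠ 0)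
    (g : ℝ → ℝ) : ∀ᵐ x ∂(volume.restrict (Icc (0 : ℝ) 1)),
      μ x • (ρ x / μ x * g x) = ρ x • g x := by
  filter_upwards [hac] with x hx
  rcases eq_or_ne (μ x) 0 with h | h
  · have : ρ x = 0 := by_contra fun h' => hx h' h
    simp [h, this]
  · simp only [smul_eq_mul]
    field_simp

theorem integrable_div_mul_iff (hρ : IsWeight ρ) (hμ : IsWeight μ)
    (hac : ∀ᵐ x ∂(volume.restrict (Icc (0 : ℝ) 1)), ρ x ≠ 0 → μ x ≠ 0) (g : ℝ → ℝ) :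
    Integrable (fun x => ρ x / μ x * g x) (densityMeasure μ) ↔
      Integrable g (densityMeasure ρ) := by
  rw [hρ.integrable_iff, hμ.integrable_iff]
  exact integrable_congr (ae_smul_div_mul hac g)

theorem integral_div_mul (hρ : IsWeight ρ) (hμ : IsWeight μ)
    (hac : ∀ᵐ x ∂(volume.restrict (Icc (0 : ℝ) 1)), ρ x ≠ 0 → μ x ≠ 0) (g : ℝ → ℝ) :
    ∫ x, ρ x / μ x * g x ∂(densityMeasure μ) = ∫ x, g x ∂(densityMeasure ρ) := by
  rw [hρ.integral_eq, hμ.integral_eq]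
  exact integral_congr_ae (ae_smul_div_mul hac g)

theorem inner_divMulIsometry_left (hρ : IsWeight ρ) (hμ : IsWeight μ)
    (hv : IsWeight (fun x => ρ x ^ 2 / μ x))
    (hq : MemLp (fun x => ρ x / μ x) 2 (densityMeasure μ))
    (hac : ∀ᵐ x ∂(volume.restrict (Icc (0 : ℝ) 1)), ρ x ≠ 0 → μ x ≠ 0)
    (f : WeightedL2 (fun x => ρ x ^ 2 / μ x)) (h : WeightedL2 μ) :
    Integrable (fun x => f x * h x) (densityMeasure ρ) ∧
      inner ℝ (divMulIsometry hμ hv hq f) h = ∫ x, f x * h x ∂(densityMeasure ρ) := by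
  have h1 : (fun x => inner ℝ (divMulIsometry hμ hv hq f x) (h x)) =ᵐ[densityMeasure μ]
      fun x => ρ x / μ x * (f x * h x) := by
    filter_upwards [coeFn_divMulIsometry hμ hv hq f] with x hx
    rw [hx, real_inner_comm]
    simp only [RCLike.inner_apply, conj_trivial]
    ring
  refine ⟨(integrable_div_mul_iff hρ hμ hac _).1 ((L2.integrable_inner _ _).congr h1), ?_⟩
  rw [L2.inner_def, integral_congr_ae h1, integral_div_mul hρ hμ hac]

end Transfer

/-! ### The reducer as an element of `L²(ρ)`. -/

section Reducer

variable {ρ μ : ℝ → ℝ}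

theorem IsWeight.reducerApprox_eq (hρ : IsWeight ρ) (ε x : ℝ) :
    reducerApprox ρ ε x = ∫ t, 2 * ((x - t) / ((x - t) ^ 2 + ε ^ 2)) ∂(densityMeasure ρ) := by
  rw [hρ.integral_eq, reducerApprox, ← integral_const_mul]
  congr 1 with t
  rw [smul_eq_mul]
  ring

theorem continuous_conjugateKernel {ε : ℝ} (hε : 0 < ε) :
    Continuous fun s : ℝ => s / (s ^ 2 + ε ^ 2) :=
  Continuous.div (by fun_prop) (by fun_prop) fun s => by positivity

theorem abs_conjugateKernel_le {ε : ℝ} (hε : 0 < ε) (s : ℝ) : |s / (s ^ 2 + ε ^ 2)| ≤ ε⁻¹ := by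
  rw [abs_div, abs_of_pos (by positivity : 0 < s ^ 2 + ε ^ 2),
    div_le_iff₀ (by positivity), ← sq_abs s]
  field_simp
  nlinarith [sq_nonneg (|s| - ε), abs_nonneg s]

theorem IsWeight.memLp_reducerApprox (hρ : IsWeight ρ) {ε : ℝ} (hε : 0 < ε) :
    MemLp (reducerApprox ρ ε) 2 (densityMeasure ρ) := by
  have := hρ.isFiniteMeasure
  have hm : StronglyMeasurable (reducerApprox ρ ε) := by
    rw [show reducerApprox ρ ε = _ from funext (hρ.reducerApprox_eq ε)]
    refine StronglyMeasurable.integral_prod_right'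
      (f := fun p : ℝ × ℝ => 2 * ((p.1 - p.2) / ((p.1 - p.2) ^ 2 + ε ^ 2))) ?_
    exact (((continuous_conjugateKernel hε).comp
      (continuous_fst.sub continuous_snd)).const_mul 2).stronglyMeasurable
  refine MemLp.of_bound hm.aestronglyMeasurable
    (2 * ε⁻¹ * (densityMeasure ρ).real univ) (Eventually.of_forall fun x => ?_)
  rw [hρ.reducerApprox_eq]
  refine norm_integral_le_of_norm_le_const (Eventually.of_forall fun t => ?_)
  rw [norm_mul, Real.norm_ofNat, Real.norm_eq_abs]
  exact mul_le_mul_of_nonneg_left (abs_conjugateKernel_le hε _) two_pos.le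

theorem IsReducible.aestronglyMeasurable_reducer (hρ : IsWeight ρ) (hred : IsReducible ρ μ) :
    AEStronglyMeasurable (reducer ρ) (densityMeasure ρ) := by
  let ε : ℕ → ℝ := fun n => 1 / ((n : ℝ) + 1)
  have hε : ∀ n, 0 < ε n := fun n => Nat.one_div_pos_of_nat
  have hε0 : Tendsto ε atTop (𝓝[>] 0) :=
    tendsto_nhdsWithin_iff.2 ⟨tendsto_one_div_add_atTop_nhds_zero_nat, Eventually.of_forall hε⟩
  refine aestronglyMeasurable_of_tendsto_ae atTop (f := fun n => reducerApprox ρ (ε n))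
    (fun n => (hρ.memLp_reducerApprox (hε n)).1) ?_
  filter_upwards [(densityMeasure_absolutelyContinuous ρ).ae_le hred.exists_lim] with x hx
  exact (tendsto_nhds_limUnder hx).comp hε0

theorem IsReducible.memLp_reducer (hρ : IsWeight ρ) (hred : IsReducible ρ μ) :
    MemLp (reducer ρ) 2 (densityMeasure ρ) := by
  -- A single `ε` with finite error suffices, since `reducerApprox ρ ε` is bounded.
  obtain ⟨ε, h1, hε⟩ := ((hred.tendsto_L2.eventually (gt_mem_nhds ENNReal.zero_lt_top)).and
    self_mem_nhdsWithin).exists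
  have h2 := hρ.memLp_reducerApprox hε
  have h3 : MemLp (fun x => reducerApprox ρ ε x - reducer ρ x) 2 (densityMeasure ρ) :=
    ⟨h2.1.sub (hred.aestronglyMeasurable_reducer hρ), h1⟩
  refine (h2.sub h3).ae_eq (Eventually.of_forall fun x => ?_)
  simp

theorem IsReducible.tendsto_integral_reducerApprox (hρ : IsWeight ρ) (hred : IsReducible ρ μ)
    (p : Polynomial ℝ) :
    Tendsto (fun ε => ∫ x, p.eval x * reducerApprox ρ ε x ∂(densityMeasure ρ)) (𝓝[>] 0)
      (𝓝 (∫ x, p.eval x * reducer ρ x ∂(densityMeasure ρ))) := by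
  have hp := hρ.memLp_polynomial p
  have hr := hred.memLp_reducer hρ
  refine tendsto_integral_of_L1' _ (hp.integrable_mul hr).1 ?_ ?_
  · filter_upwards [self_mem_nhdsWithin] with ε hε
    exact hp.integrable_mul (hρ.memLp_reducerApprox hε)
  · have h0 : Tendsto (fun ε => eLpNorm (fun x => p.eval x) 2 (densityMeasure ρ) *
        eLpNorm (fun x => reducerApprox ρ ε x - reducer ρ x) 2 (densityMeasure ρ)) (𝓝[>] 0)
        (𝓝 0) := by
      simpa using ENNReal.Tendsto.const_mul hred.tendsto_L2 (Or.inr hp.2.ne)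
    refine tendsto_of_tendsto_of_tendsto_of_le_of_le' tendsto_const_nhds h0
      (Eventually.of_forall fun _ => zero_le) ?_
    filter_upwards [self_mem_nhdsWithin] with ε hε
    refine le_trans (le_of_eq ?_) (eLpNorm_smul_le_mul_eLpNorm
      ((hρ.memLp_reducerApprox hε).1.sub hr.1) hp.1 (p := 2) (q := 2) (r := 1))
    refine congrArg (fun f => eLpNorm f 1 (densityMeasure ρ)) (funext fun x => ?_)
    simp only [Pi.sub_apply, Pi.mul_apply, Pi.smul_apply', smul_eq_mul]
    ring

theorem exists_abs_eval_sub_le (p : Polynomial ℝ) : ∃ C : ℝ, 0 ≤ C ∧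
    ∀ x ∈ Icc (0 : ℝ) 1, ∀ t ∈ Icc (0 : ℝ) 1, |p.eval t - p.eval x| ≤ C * |t - x| := by
  obtain ⟨C, hC⟩ := isCompact_Icc.exists_bound_of_continuousOn (s := Icc (0 : ℝ) 1)
    p.derivative.continuous.continuousOn
  refine ⟨max C 0, le_max_right _ _, fun x hx t ht => ?_⟩
  have := (convex_Icc (0 : ℝ) 1).norm_image_sub_le_of_norm_hasDerivWithin_le
    (f := fun x => p.eval x) (f' := fun x => p.derivative.eval x) (C := max C 0)
    (fun x _ => (p.hasDerivAt x).hasDerivWithinAt) (fun x hx => (hC x hx).trans (le_max_left _ _))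
    hx ht
  simpa only [Real.norm_eq_abs] using this

/-- At `s = 0` both sides are `0` by convention, so the diagonal needs no exclusion. -/
theorem tendsto_mul_conjugateKernel (a s : ℝ) :
    Tendsto (fun ε : ℝ => a * (s / (s ^ 2 + ε ^ 2))) (𝓝[>] 0) (𝓝 (a / s)) := by
  rcases eq_or_ne s 0 with rfl | hs
  · simp
  · have h : ContinuousAt (fun ε : ℝ => a * (s / (s ^ 2 + ε ^ 2))) 0 :=
      ContinuousAt.mul (by fun_prop) (ContinuousAt.div (by fun_prop) (by fun_prop)
        (by simpa using hs))
    have h' := h.tendsto.mono_left (nhdsWithin_le_nhds (s := Ioi 0))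
    have e : a * (s / (s ^ 2 + 0 ^ 2)) = a / s := by
      field_simp
      ring
    rwa [e] at h'

theorem mul_conjugateKernel_abs_le {a s ε C : ℝ} (hε : 0 < ε) (hC : 0 ≤ C) (h : |a| ≤ C * |s|) :
    |a * (s / (s ^ 2 + ε ^ 2))| ≤ C := by
  rw [abs_mul, abs_div, abs_of_pos (by positivity : 0 < s ^ 2 + ε ^ 2), mul_div_assoc',
    div_le_iff₀ (by positivity)]
  calc |a| * |s| ≤ C * |s| * |s| := mul_le_mul_of_nonneg_right h (abs_nonneg _)
    _ = C * s ^ 2 := by rw [mul_assoc, ← sq, sq_abs]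
    _ ≤ C * (s ^ 2 + ε ^ 2) := by gcongr; nlinarith [sq_nonneg ε]

end Reducer

/-! ### The reducer identity by symmetrisation. -/

section ReducerIdentity

variable {ρ μ : ℝ → ℝ}

theorem ae_prod_mem_Icc {ν : Measure ℝ} [IsFiniteMeasure ν] (hν : ν (Icc (0 : ℝ) 1)ᶜ = 0) :
    ∀ᵐ z ∂(ν.prod ν), z.1 ∈ Icc (0 : ℝ) 1 ∧ z.2 ∈ Icc (0 : ℝ) 1 :=
  (Measure.quasiMeasurePreserving_fst.ae hν).and (Measure.quasiMeasurePreserving_snd.ae hν)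

theorem Continuous.integrable_prod_of_compl_Icc {ν : Measure ℝ} [IsFiniteMeasure ν]
    (hν : ν (Icc (0 : ℝ) 1)ᶜ = 0) {F : ℝ × ℝ → ℝ} (hF : Continuous F) :
    Integrable F (ν.prod ν) := by
  obtain ⟨C, hC⟩ := ((isCompact_Icc (a := (0 : ℝ)) (b := 1)).prod
    (isCompact_Icc (a := (0 : ℝ)) (b := 1))).exists_bound_of_continuousOn hF.continuousOn
  refine Integrable.of_bound hF.aestronglyMeasurable C ?_
  filter_upwards [ae_prod_mem_Icc hν] with z hz using hC z hz

/-- The cross terms `A` are symmetric in the two variables while the kernel is odd, so they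
integrate to zero. The remaining `-2 p q` at the first variable, in `B`, reproduces `reducerApprox`.
-/
theorem IsWeight.integral_prod_conjugateKernel (hρ : IsWeight ρ) (p q : Polynomial ℝ) {ε : ℝ}
    (hε : 0 < ε) :
    ∫ z, (p.eval z.1 * (q.eval z.2 - q.eval z.1) + q.eval z.1 * (p.eval z.2 - p.eval z.1)) *
        ((z.2 - z.1) / ((z.2 - z.1) ^ 2 + ε ^ 2)) ∂((densityMeasure ρ).prod (densityMeasure ρ)) =
      ∫ x, (p * q).eval x * reducerApprox ρ ε x ∂(densityMeasure ρ) := by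
  have := hρ.isFiniteMeasure
  set ν := densityMeasure ρ
  have hν : ν (Icc (0 : ℝ) 1)ᶜ = 0 := densityMeasure_compl_Icc ρ
  have hk : Continuous fun z : ℝ × ℝ => (z.2 - z.1) / ((z.2 - z.1) ^ 2 + ε ^ 2) :=
    (continuous_conjugateKernel hε).comp (continuous_snd.sub continuous_fst)
  have hp1 : Continuous fun z : ℝ × ℝ => p.eval z.1 := p.continuous.comp continuous_fst
  have hp2 : Continuous fun z : ℝ × ℝ => p.eval z.2 := p.continuous.comp continuous_snd
  have hq1 : Continuous fun z : ℝ × ℝ => q.eval z.1 := q.continuous.comp continuous_fst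
  have hq2 : Continuous fun z : ℝ × ℝ => q.eval z.2 := q.continuous.comp continuous_snd
  let A : ℝ × ℝ → ℝ := fun z => (p.eval z.1 * q.eval z.2 + q.eval z.1 * p.eval z.2) *
    ((z.2 - z.1) / ((z.2 - z.1) ^ 2 + ε ^ 2))
  let B : ℝ × ℝ → ℝ := fun z => (p.eval z.1 * q.eval z.1) *
    (2 * ((z.1 - z.2) / ((z.1 - z.2) ^ 2 + ε ^ 2)))
  have hA : Integrable A (ν.prod ν) :=
    Continuous.integrable_prod_of_compl_Icc hν (((hp1.mul hq2).add (hq1.mul hp2)).mul hk)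
  have hB : Integrable B (ν.prod ν) :=
    Continuous.integrable_prod_of_compl_Icc hν ((hp1.mul hq1).mul
      (((continuous_conjugateKernel hε).comp (continuous_fst.sub continuous_snd)).const_mul 2))
  have hA0 : ∫ z, A z ∂(ν.prod ν) = 0 := by
    have h1 := integral_prod_swap (μ := ν) (ν := ν) A
    have h2 : ∀ z : ℝ × ℝ, A z.swap = -A z := fun z => by
      have e : (z.1 - z.2) ^ 2 = (z.2 - z.1) ^ 2 := by ring
      simp only [A, Prod.fst_swap, Prod.snd_swap, e]
      ring
    simp only [h2, integral_neg] at h1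
    linarith
  have hsum : ∀ z : ℝ × ℝ, (p.eval z.1 * (q.eval z.2 - q.eval z.1) +
      q.eval z.1 * (p.eval z.2 - p.eval z.1)) * ((z.2 - z.1) / ((z.2 - z.1) ^ 2 + ε ^ 2)) =
      A z + B z := fun z => by
    have e : (z.1 - z.2) ^ 2 = (z.2 - z.1) ^ 2 := by ring
    simp only [A, B, e]
    ring
  simp only [hsum]
  rw [integral_add hA hB, hA0, zero_add, integral_prod _ hB]
  refine integral_congr_ae (Eventually.of_forall fun x => ?_)
  simp only [B]
  rw [hρ.reducerApprox_eq, integral_const_mul, Polynomial.eval_mul]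

/-- The transpose of the secondary polynomial operator, for the weight `ρ` on both sides, is
multiplication by the reducer minus the operator itself. -/
theorem IsReducible.moment_add_moment (hρ : IsWeight ρ) (hred : IsReducible ρ μ)
    (p q : Polynomial ℝ) :
    hρ.moment (p * hρ.secondaryPolynomial q) + hρ.moment (q * hρ.secondaryPolynomial p) =
      ∫ x, (p * q).eval x * reducer ρ x ∂(densityMeasure ρ) := by
  have := hρ.isFiniteMeasure
  set ν := densityMeasure ρ
  have hν : ν (Icc (0 : ℝ) 1)ᶜ = 0 := densityMeasure_compl_Icc ρ
  let a : ℝ × ℝ → ℝ := fun z => p.eval z.1 * (q.eval z.2 - q.eval z.1) +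
    q.eval z.1 * (p.eval z.2 - p.eval z.1)
  have hac : Continuous a := by
    have hp1 : Continuous fun z : ℝ × ℝ => p.eval z.1 := p.continuous.comp continuous_fst
    have hp2 : Continuous fun z : ℝ × ℝ => p.eval z.2 := p.continuous.comp continuous_snd
    have hq1 : Continuous fun z : ℝ × ℝ => q.eval z.1 := q.continuous.comp continuous_fst
    have hq2 : Continuous fun z : ℝ × ℝ => q.eval z.2 := q.continuous.comp continuous_snd
    exact (hp1.mul (hq2.sub hq1)).add (hq1.mul (hp2.sub hp1))
  -- The numerator vanishes to first order on the diagonal, so `C` dominates the regularised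
  -- integrands uniformly in `ε`.
  obtain ⟨C, hC0, hC⟩ : ∃ C : ℝ, 0 ≤ C ∧ ∀ᵐ z ∂(ν.prod ν), |a z| ≤ C * |z.2 - z.1| := by
    obtain ⟨Cp, hCp0, hCp⟩ := exists_abs_eval_sub_le p
    obtain ⟨Cq, hCq0, hCq⟩ := exists_abs_eval_sub_le q
    obtain ⟨Mp, hMp⟩ := isCompact_Icc.exists_bound_of_continuousOn (s := Icc (0 : ℝ) 1)
      p.continuous.continuousOn
    obtain ⟨Mq, hMq⟩ := isCompact_Icc.exists_bound_of_continuousOn (s := Icc (0 : ℝ) 1)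
      q.continuous.continuousOn
    have hMp0 : 0 ≤ Mp := (norm_nonneg _).trans (hMp 0 (by simp))
    have hMq0 : 0 ≤ Mq := (norm_nonneg _).trans (hMq 0 (by simp))
    refine ⟨Mp * Cq + Mq * Cp, by positivity, ?_⟩
    filter_upwards [ae_prod_mem_Icc hν] with z hz
    calc |a z| ≤ |p.eval z.1| * |q.eval z.2 - q.eval z.1| +
          |q.eval z.1| * |p.eval z.2 - p.eval z.1| := by
          rw [← abs_mul, ← abs_mul]
          exact abs_add_le _ _
      _ ≤ Mp * (Cq * |z.2 - z.1|) + Mq * (Cp * |z.2 - z.1|) :=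
          add_le_add
            (mul_le_mul (hMp _ hz.1) (hCq _ hz.1 _ hz.2) (abs_nonneg _) hMp0)
            (mul_le_mul (hMq _ hz.1) (hCp _ hz.1 _ hz.2) (abs_nonneg _) hMq0)
      _ = _ := by ring
  have hlim : Tendsto (fun ε : ℝ => ∫ z, a z *
      ((z.2 - z.1) / ((z.2 - z.1) ^ 2 + ε ^ 2)) ∂(ν.prod ν)) (𝓝[>] 0)
      (𝓝 (∫ z, a z / (z.2 - z.1) ∂(ν.prod ν))) := by
    refine tendsto_integral_filter_of_dominated_convergence (fun _ => C) ?_ ?_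
      (integrable_const _) (Eventually.of_forall fun z => tendsto_mul_conjugateKernel _ _)
    · filter_upwards [self_mem_nhdsWithin] with ε hε
      exact (hac.mul ((continuous_conjugateKernel hε).comp
        (continuous_snd.sub continuous_fst))).aestronglyMeasurable
    · filter_upwards [self_mem_nhdsWithin] with ε hε
      filter_upwards [hC] with z hz using mul_conjugateKernel_abs_le hε hC0 hz
  have hlim2 := hred.tendsto_integral_reducerApprox hρ (p * q)
  have heq : ∫ z, a z / (z.2 - z.1) ∂(ν.prod ν) =
      ∫ x, (p * q).eval x * reducer ρ x ∂ν := by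
    refine tendsto_nhds_unique hlim (hlim2.congr' ?_)
    filter_upwards [self_mem_nhdsWithin] with ε hε
    exact (hρ.integral_prod_conjugateKernel p q hε).symm
  rw [← heq, integral_prod]
  · rw [← map_add, IsWeight.moment_apply]
    refine integral_congr_ae (Eventually.of_forall fun x => ?_)
    simp only [a, Polynomial.eval_add, Polynomial.eval_mul, hρ.eval_secondaryPolynomial,
      hρ.secondaryTransform_eq]
    rw [← integral_const_mul, ← integral_const_mul, ← integral_add
      ((hρ.integrable_diffQuot x q).const_mul _) ((hρ.integrable_diffQuot x p).const_mul _)]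
    congr 1 with t
    ring
  · refine Integrable.of_bound (C := C) ?_ ?_
    · exact (hac.measurable.div (measurable_snd.sub measurable_fst)).aestronglyMeasurable
    · filter_upwards [hC] with z hz
      rw [Real.norm_eq_abs, abs_div]
      exact div_le_of_le_mul₀ (abs_nonneg _) hC0 hz

end ReducerIdentity

/-! ### The isometry `U_ρ` and its formula. -/

section MainTheorem

variable {ρ μ : ℝ → ℝ}

theorem IsReducible.memLp_div (hred : IsReducible ρ μ) :
    MemLp (fun x => ρ x / μ x) 2 (densityMeasure μ) := by
  obtain ⟨f, hf⟩ := hred.quotient_mem_range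
  exact (Lp.memLp _).ae_eq hf

theorem exists_subseq_tendsto_ae {ν : Measure ℝ} {F : ℕ → Lp ℝ 2 ν} {f : Lp ℝ 2 ν}
    (h : Tendsto F atTop (𝓝 f)) : ∃ ns : ℕ → ℕ, StrictMono ns ∧
      ∀ᵐ x ∂ν, Tendsto (fun n => F (ns n) x) atTop (𝓝 (f x)) :=
  (tendstoInMeasure_of_tendsto_Lp h).exists_seq_tendsto_ae

/-- Approximation in `L²` of the sum of the two measures, which dominates each, gives one sequence
that serves both spaces. -/
theorem exists_seq_polyLp_tendsto {v w : ℝ → ℝ} (hv : IsWeight v) (hw : IsWeight w) {f : ℝ → ℝ}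
    (hfv : MemLp f 2 (densityMeasure v)) (hfw : MemLp f 2 (densityMeasure w)) :
    ∃ p : ℕ → Polynomial ℝ, Tendsto (fun n => hv.polyLp (p n)) atTop (𝓝 (hfv.toLp f)) ∧
      Tendsto (fun n => hw.polyLp (p n)) atTop (𝓝 (hfw.toLp f)) := by
  have := hv.isFiniteMeasure
  have := hw.isFiniteMeasure
  set ν := densityMeasure v + densityMeasure w with hνdef
  have hν : ν (Icc (0 : ℝ) 1)ᶜ = 0 := by
    rw [hνdef, Measure.add_apply, densityMeasure_compl_Icc, densityMeasure_compl_Icc, add_zero]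
  have hf : MemLp f 2 ν := by
    rw [memLp_two_iff_integrable_sq (hfv.1.add_measure hfw.1)]
    exact hfv.integrable_sq.add_measure hfw.integrable_sq
  have hε (n : ℕ) : ((n : ENNReal) + 1)⁻¹ ≠ 0 := by simp
  choose p hp using fun n : ℕ => hf.exists_polynomial_eLpNorm_sub_le hν (hε n)
  have h0 : Tendsto (fun n : ℕ => ((n : ENNReal) + 1)⁻¹) atTop (𝓝 0) := by
    have := (tendsto_add_atTop_iff_nat 1).2 ENNReal.tendsto_inv_nat_nhds_zero
    simpa using this
  have key {u : ℝ → ℝ} (hu : IsWeight u) (hfu : MemLp f 2 (densityMeasure u))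
      (hle : densityMeasure u ≤ ν) :
      Tendsto (fun n => hu.polyLp (p n)) atTop (𝓝 (hfu.toLp f)) := by
    rw [tendsto_iff_edist_tendsto_0]
    refine tendsto_of_tendsto_of_tendsto_of_le_of_le tendsto_const_nhds h0
      (fun _ => zero_le) fun n => ?_
    rw [edist_comm, hu.polyLp_apply _ (hu.memLp_polynomial _), Lp.edist_toLp_toLp]
    exact (eLpNorm_mono_measure _ hle).trans (hp n)
  exact ⟨p, key hv hfv (Measure.le_add_right le_rfl), key hw hfw (Measure.le_add_left le_rfl)⟩

/-- The isometry `f ↦ T_ρ^* ((ρ / μ) f)` from `L²([0,1], ρ² / μ)` into `H_ρ`. -/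
def transposeIsometry (hρ : IsContinuousProbDensity ρ) (hμ : IsSecondaryDensity ρ μ)
    (hq : MemLp (fun x => ρ x / μ x) 2 (densityMeasure μ)) :
    WeightedL2 (fun x => ρ x ^ 2 / μ x) →ₗᵢ[ℝ] orthHyperplane ρ where
  toLinearMap := LinearMap.codRestrict (orthHyperplane ρ)
    ((ContinuousLinearMap.adjoint (secondaryOperator ρ μ)).toLinearMap ∘ₗ
      (divMulIsometry hμ.isWeight (hμ.isWeight.sq_div hq) hq).toLinearMap)
    fun _ => adjoint_secondaryOperator_mem hρ hμ _
  norm_map' f := (norm_adjoint_secondaryOperator hρ hμ _).trans (LinearIsometry.norm_map _ f)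

theorem coe_transposeIsometry (hρ : IsContinuousProbDensity ρ) (hμ : IsSecondaryDensity ρ μ)
    (hq : MemLp (fun x => ρ x / μ x) 2 (densityMeasure μ))
    (f : WeightedL2 (fun x => ρ x ^ 2 / μ x)) :
    (transposeIsometry hρ hμ hq f : WeightedL2 ρ) =
      ContinuousLinearMap.adjoint (secondaryOperator ρ μ)
        (divMulIsometry hμ.isWeight (hμ.isWeight.sq_div hq) hq f) := rfl

theorem inner_transposeIsometry_left (hρ : IsContinuousProbDensity ρ)
    (hμ : IsSecondaryDensity ρ μ) (hq : MemLp (fun x => ρ x / μ x) 2 (densityMeasure μ))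
    (hac : ∀ᵐ x ∂(volume.restrict (Icc (0 : ℝ) 1)), ρ x ≠ 0 → μ x ≠ 0)
    (f : WeightedL2 (fun x => ρ x ^ 2 / μ x)) (g : WeightedL2 ρ) :
    Integrable (fun x => f x * secondaryOperator ρ μ g x) (densityMeasure ρ) ∧
      inner ℝ (transposeIsometry hρ hμ hq f : WeightedL2 ρ) g =
        ∫ x, f x * secondaryOperator ρ μ g x ∂(densityMeasure ρ) := by
  rw [coe_transposeIsometry, ContinuousLinearMap.adjoint_inner_left]
  exact inner_divMulIsometry_left hρ.isWeight hμ.isWeight _ hq hac f _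

/-- Tested against a polynomial `q`, the left side gives `L (p Q q)` and the right side `∫ p q φ ρ -
L (q Q p)`; these agree by `IsReducible.moment_add_moment`, and polynomials are dense. -/
theorem transposeIsometry_polyLp (hρ : IsContinuousProbDensity ρ) (hμ : IsSecondaryDensity ρ μ)
    (hred : IsReducible ρ μ) (p : Polynomial ℝ) :
    (transposeIsometry hρ hμ hred.memLp_div
      ((hμ.isWeight.sq_div hred.memLp_div).polyLp p) : WeightedL2 ρ)
      =ᵐ[densityMeasure ρ] fun x => reducer ρ x * p.eval x
        - secondaryOperator ρ μ (hρ.isWeight.polyLp p) x := by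
  have := hρ.isWeight.isFiniteMeasure
  set hv := hμ.isWeight.sq_div hred.memLp_div
  have hac := ae_secondaryDensity_ne_zero hρ hμ hred.exists_lim
  have habs := densityMeasure_absolutelyContinuous_secondary hρ hμ hred.exists_lim
  have hr := hred.memLp_reducer hρ.isWeight
  -- `T q` is determined only `μ`-almost everywhere; absolute continuity makes its values meaningful
  -- for `ρ`.
  have hT (q : Polynomial ℝ) : secondaryOperator ρ μ (hρ.isWeight.polyLp q) =ᵐ[densityMeasure ρ]
      fun x => (hρ.isWeight.secondaryPolynomial q).eval x := by
    rw [secondaryOperator_polyLp hρ hμ]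
    exact habs.ae_le (hμ.isWeight.coeFn_polyLp _)
  obtain ⟨M, hM⟩ := isCompact_Icc.exists_bound_of_continuousOn (s := Icc (0 : ℝ) 1)
    p.continuous.continuousOn
  have hrp : MemLp (fun x => reducer ρ x * p.eval x) 2 (densityMeasure ρ) := by
    refine hr.of_le_mul (c := M) (hr.1.mul (hρ.isWeight.memLp_polynomial p).1) ?_
    filter_upwards [show ∀ᵐ x ∂(densityMeasure ρ), x ∈ Icc (0 : ℝ) 1 from
      densityMeasure_compl_Icc ρ] with x hx
    rw [norm_mul, mul_comm]
    exact mul_le_mul_of_nonneg_right (hM x hx) (norm_nonneg _)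
  have hV := hrp.sub (hρ.isWeight.memLp_polynomial (hρ.isWeight.secondaryPolynomial p))
  have hUV : (transposeIsometry hρ hμ hred.memLp_div (hv.polyLp p) : WeightedL2 ρ) =
      hV.toLp _ := by
    refine hρ.isWeight.denseRange_polyLp.eq_of_inner_right ℝ fun q => ?_
    rw [real_inner_comm, (inner_transposeIsometry_left hρ hμ hred.memLp_div hac _ _).2,
      hρ.isWeight.inner_polyLp_left]
    have h1 : ∫ x, hv.polyLp p x * secondaryOperator ρ μ (hρ.isWeight.polyLp q) x
        ∂(densityMeasure ρ) = hρ.isWeight.moment (p * hρ.isWeight.secondaryPolynomial q) := by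
      rw [IsWeight.moment_apply]
      refine integral_congr_ae ?_
      have hvp : ∀ᵐ x ∂(densityMeasure ρ), hv.polyLp p x = p.eval x := by
        rw [hρ.isWeight.ae_iff]
        filter_upwards [hv.ae_iff.1 (hv.coeFn_polyLp p), hac] with x h2 h3 h4
        exact h2 (div_ne_zero (pow_ne_zero 2 h4) (h3 h4))
      filter_upwards [hvp, hT q] with x h2 h3
      rw [h2, h3, Polynomial.eval_mul]
    have h2 : ∫ x, q.eval x * hV.toLp _ x ∂(densityMeasure ρ) =
        ∫ x, ((p * q).eval x * reducer ρ x -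
          (q * hρ.isWeight.secondaryPolynomial p).eval x) ∂(densityMeasure ρ) := by
      refine integral_congr_ae ?_
      filter_upwards [MemLp.coeFn_toLp hV] with x hx
      rw [hx]
      simp only [Pi.sub_apply, Polynomial.eval_mul]
      ring
    rw [h1, h2, integral_sub (f := fun x => (p * q).eval x * reducer ρ x)
      ((hρ.isWeight.memLp_polynomial (p * q)).integrable_mul hr)
      (integrable_polynomial (densityMeasure_compl_Icc ρ) _),
      ← hred.moment_add_moment hρ.isWeight p q, ← IsWeight.moment_apply hρ.isWeight]
    ring
  rw [hUV]
  filter_upwards [MemLp.coeFn_toLp hV, hT p] with x h1 h2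
  rw [h1, h2, Pi.sub_apply]

/-- The products `φ pₙ` need not converge in `L²(ρ)`, so the limit is taken pointwise: nested
subsequences make `pₙ`, `T pₙ` and `U pₙ` all converge `ρ`-almost everywhere. -/
theorem transposeIsometry_toLp (hρ : IsContinuousProbDensity ρ) (hμ : IsSecondaryDensity ρ μ)
    (hred : IsReducible ρ μ) {f : ℝ → ℝ} (hf : MemLp f 2 (densityMeasure ρ))
    (hf' : MemLp f 2 (densityMeasure (fun x => ρ x ^ 2 / μ x))) :
    (transposeIsometry hρ hμ hred.memLp_div (hf'.toLp f) : WeightedL2 ρ)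
      =ᵐ[densityMeasure ρ] fun x => reducer ρ x * f x
        - secondaryOperator ρ μ (hf.toLp f) x := by
  set hv := hμ.isWeight.sq_div hred.memLp_div
  set U := transposeIsometry hρ hμ hred.memLp_div
  have habs := densityMeasure_absolutelyContinuous_secondary hρ hμ hred.exists_lim
  obtain ⟨p, hp, hp'⟩ := exists_seq_polyLp_tendsto hρ.isWeight hv hf hf'
  have hTp := ((secondaryOperator ρ μ).continuous.tendsto _).comp hp
  have hUp := ((continuous_subtype_val.comp U.continuous).tendsto _).comp hp'
  obtain ⟨a, ha, hae⟩ := exists_subseq_tendsto_ae hp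
  obtain ⟨b, hb, hbe⟩ := exists_subseq_tendsto_ae (hTp.comp ha.tendsto_atTop)
  obtain ⟨c, hc, hce⟩ := exists_subseq_tendsto_ae
    (hUp.comp (ha.tendsto_atTop.comp hb.tendsto_atTop))
  have hall : ∀ᵐ x ∂(densityMeasure ρ), ∀ n, hρ.isWeight.polyLp (p n) x = (p n).eval x ∧
      (U (hv.polyLp (p n)) : WeightedL2 ρ) x = reducer ρ x * (p n).eval x
        - secondaryOperator ρ μ (hρ.isWeight.polyLp (p n)) x :=
    ae_all_iff.2 fun n => (hρ.isWeight.coeFn_polyLp (p n)).and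
      (transposeIsometry_polyLp hρ hμ hred (p n))
  filter_upwards [hae, habs.ae_le hbe, hce, hall, MemLp.coeFn_toLp hf] with x h1 h2 h3 h4 h5
  rw [h5] at h1
  have h6 : Tendsto (fun n => reducer ρ x * hρ.isWeight.polyLp (p (a (b (c n)))) x
      - secondaryOperator ρ μ (hρ.isWeight.polyLp (p (a (b (c n))))) x) atTop
      (𝓝 (reducer ρ x * f x - secondaryOperator ρ μ (hf.toLp f) x)) :=
    ((h1.comp (hb.tendsto_atTop.comp hc.tendsto_atTop)).const_mul _).sub
      (h2.comp hc.tendsto_atTop)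
  refine tendsto_nhds_unique h3 (h6.congr fun n => ?_)
  rw [(h4 _).1]
  exact (h4 _).2.symm

end MainTheorem

end

theorem mainTheorem4 (ρ μ : ℝ → ℝ)
    (hρ : IsContinuousProbDensity ρ)
    (hμ : IsSecondaryDensity ρ μ)
    (hred : IsReducible ρ μ) :
    -- `T_ρ` is indeed the continuous extension of the operator creating secondary polynomials
    IsSecondaryExtension ρ μ (secondaryOperator ρ μ) ∧
    ∃ U : WeightedL2 (fun x => ρ x ^ 2 / μ x) →ₗᵢ[ℝ] orthHyperplane ρ,
      -- polynomials lie in all the spaces involved, and `U p = φ p - T_ρ p` for them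
      (∀ p : Polynomial ℝ,
        ∃ (hp : MemLp (fun x => p.eval x) 2 (densityMeasure ρ))
          (hp' : MemLp (fun x => p.eval x) 2 (densityMeasure (fun x => ρ x ^ 2 / μ x))),
          (U (hp'.toLp (fun x => p.eval x)) : WeightedL2 ρ) =ᵐ[densityMeasure ρ]
            fun x => reducer ρ x * p.eval x
              - secondaryOperator ρ μ (hp.toLp (fun x => p.eval x)) x) ∧
      -- `U f = φ f - T_ρ f` whenever `φ f` and `T_ρ f` belong to `L²(ρ)`
      (∀ (f : ℝ → ℝ) (hf : MemLp f 2 (densityMeasure ρ))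
        (hf' : MemLp f 2 (densityMeasure (fun x => ρ x ^ 2 / μ x))),
        MemLp (fun x => reducer ρ x * f x) 2 (densityMeasure ρ) →
        MemLp (secondaryOperator ρ μ (hf.toLp f)) 2 (densityMeasure ρ) →
        (U (hf'.toLp f) : WeightedL2 ρ) =ᵐ[densityMeasure ρ]
          fun x => reducer ρ x * f x - secondaryOperator ρ μ (hf.toLp f) x) ∧
      -- `T_ρ (U f) = (ρ / μ) f`
      (∀ f : WeightedL2 (fun x => ρ x ^ 2 / μ x),
        secondaryOperator ρ μ (U f : WeightedL2 ρ) =ᵐ[densityMeasure μ]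
          fun x => ρ x / μ x * f x) ∧
      -- `⟨U f, g⟩_ρ = ⟨f, T_ρ g⟩_ρ`
      (∀ (f : WeightedL2 (fun x => ρ x ^ 2 / μ x)) (g : WeightedL2 ρ),
        Integrable (fun x => f x * secondaryOperator ρ μ g x) (densityMeasure ρ) ∧
        inner ℝ (U f : WeightedL2 ρ) g =
          ∫ x, f x * secondaryOperator ρ μ g x ∂(densityMeasure ρ)) := by
  have hq := hred.memLp_div
  have hv := hμ.isWeight.sq_div hq
  have hac := ae_secondaryDensity_ne_zero hρ hμ hred.exists_lim
  refine ⟨isSecondaryExtension_secondaryOperator hρ hμ, transposeIsometry hρ hμ hq,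
    fun p => ⟨hρ.isWeight.memLp_polynomial p, hv.memLp_polynomial p, ?_⟩,
    fun f hf hf' _ _ => transposeIsometry_toLp hρ hμ hred hf hf', fun f => ?_,
    fun f g => inner_transposeIsometry_left hρ hμ hq hac f g⟩
  · exact transposeIsometry_polyLp hρ hμ hred p
  · rw [coe_transposeIsometry, secondaryOperator_adjoint hρ hμ]
    exact coeFn_divMulIsometry _ _ _ f
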